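/- Let $C>0$, $G\ge 0$, $M\ge 0$, $0<Y<2$, and put $\theta=(G-M)/2$, $\tilde\theta=(G+M)/2$. Let $\gamma_{Y/2}$ and $\gamma_{1/2}$ be independent gamma random variables with unit scale and shapes $Y/2$ and $1/2$, and $\mathcal R=\gamma_{Y/2}/\gamma_{1/2}$. Let $\mathcal T=\{\mathcal T(t),t\ge 0\}$ be the time change subordinator of the CGMY process with parameters $C,G,M,Y$, that is, a driftless subordinator with Lévy density $$\nu_{\mathcal T}(x)=C\,\frac{2^{Y/2-1}\Gamma(Y/2)}{\Gamma(Y)}\,\frac{e^{-(\tilde\theta^2-\theta^2)x/2}}{x^{1+Y/2}}\,\mathrm E\!\left[\exp\!\left(-\frac{\tilde\theta^2x}{2}\,\mathcal R\right)\right],\qquad x>0 .$$ Fix $t>0$ and put $\widetilde C=tC2^{Y/2-1}/\Gamma(Y)$. Then for every $L>0$ there are random variables $\mathcal T_L(t)$ and $\epsilon_L(t)$, on the probability space of $\mathcal T$, such that $$\mathcal T(t)=\mathcal T_L(t)+\epsilon_L(t),$$ $\mathcal T_L(t)$ and $\epsilon_L(t)$ are independent, and the following hold. (i) For every $L>0$,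 $\mathcal T_L(t)$ is a generalized gamma convolution random variable (a nonnegative random variable with Laplace transform $\exp(-\int_{(0,\infty)}\log(1+\mu/x)\,U(dx))$, $\mu\ge0$, for some Radon measure $U$ on $(0,\infty)$ with $\int_{(0,1]}|\log x|\,U(dx)<\infty$ and $\int_{(1,\infty)}x^{-1}U(dx)<\infty$), and for all $\mu>0$ $$-\log \mathrm E\!\left[e^{-\mu\mathcal T_L(t)}\right]=\frac{2\widetilde C L^{Y/2}}{Y}\,\mathrm E\left[\log(1+\mu R)\right]<\infty,\qquad R=\frac{1}{\frac{GM+\tilde\theta^2\mathcal R}{2}+\mathcal Z},$$ where $\mathcal Z$ is independent of $\mathcal R$ and has density $\frac Y2L^{-Y/2}z^{Y/2-1}$ on $0\le z\le L$. (ii) As $L\to\infty$, the standardized remainder $(\epsilon_L(t)-\mathrm E[\epsilon_L(t)])/\sqrt{\mathrm{Var}(\epsilon_L(t))}$ converges in distribution to a standard normal random variable. Moreover, for every $L>0$, $\epsilon_L(t)$ is square integrable and $$\mathrm E[\epsilon_L(t)^2]\le\frac{\widetilde C^2}{(1-Y/2)^2L^{2-Y}}+\frac{\widetilde C}{(2-Y/2)L^{2-Y/2}}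 .$$ -/

import Mathlib

open MeasureTheory ProbabilityTheory Filter Set
open scoped NNReal ENNReal

noncomputable section

namespace CGMY

/-- A real-valued process `T` indexed by `[0, ∞)` is a subordinator under `P`: it starts at `0`,
has independent and stationary increments, and almost all its paths are nondecreasing and
right-continuous (hence càdlàg). -/
structure IsSubordinator {Ω : Type*} [MeasurableSpace Ω] (T : ℝ≥0 → Ω → ℝ) (P : Measure Ω) :
    Prop where
  measurable : ∀ s, Measurable (T s)
  zero : ∀ᵐ ω ∂P, T 0 ω = 0
  indep : HasIndepIncrements T P
  stationary : ∀ s h, IdentDistrib (fun ω => T (s + h) ω - T s ω) (T h) P P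
  paths : ∀ᵐ ω ∂P, Monotone (fun s => T s ω) ∧
    ∀ s, ContinuousWithinAt (fun r => T r ω) (Ici s) s

/-- The subordinator `T` has no drift and has Lévy measure `ν(x) dx` on `(0, ∞)`
(Lévy–Khintchine formula of a subordinator). -/
structure HasLevyDensity {Ω : Type*} [MeasurableSpace Ω] (T : ℝ≥0 → Ω → ℝ) (P : Measure Ω)
    (ν : ℝ → ℝ) : Prop where
  nonneg : ∀ x, 0 < x → 0 ≤ ν x
  integrable : IntegrableOn (fun x => min 1 x * ν x) (Ioi 0)
  laplace : ∀ (s : ℝ≥0) (u : ℝ), 0 ≤ u →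
    ∫ ω, Real.exp (-u * T s ω) ∂P =
      Real.exp (-(s : ℝ) * ∫ x in Ioi (0 : ℝ), (1 - Real.exp (-u * x)) * ν x)

/-- The law of `γ_{Y/2} / γ_{1/2}`, for independent gamma variables with unit scale and shapes
`Y/2` and `1/2`. -/
def ratioLaw (Y : ℝ) : Measure ℝ :=
  ((gammaMeasure (Y / 2) 1).prod (gammaMeasure (1 / 2) 1)).map (fun p => p.1 / p.2)

/-- `θ = (G - M) / 2`. -/
def theta (G M : ℝ) : ℝ := (G - M) / 2

/-- `θ̃ = (G + M) / 2`. -/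
def thetaTilde (G M : ℝ) : ℝ := (G + M) / 2

/-- The Lévy density of the time change of the CGMY process with parameters `C, G, M, Y`. -/
def timeChangeLevyDensity (C G M Y : ℝ) (x : ℝ) : ℝ :=
  C * (2 ^ (Y / 2 - 1) * Real.Gamma (Y / 2) / Real.Gamma Y) *
    (Real.exp (-((thetaTilde G M) ^ 2 - (theta G M) ^ 2) * x / 2) / x ^ (1 + Y / 2)) *
    ∫ r, Real.exp (-((thetaTilde G M) ^ 2 * x / 2) * r) ∂(ratioLaw Y)

/-- `C̃ = t C 2^{Y/2 - 1} / Γ(Y)`. -/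
def cTilde (C Y t : ℝ) : ℝ := t * C * 2 ^ (Y / 2 - 1) / Real.Gamma Y

/-- The law on `[0, L]` with density `(Y/2) L^{-Y/2} z^{Y/2 - 1}`. -/
def zLaw (Y L : ℝ) : Measure ℝ :=
  (volume.restrict (Icc 0 L)).withDensity
    (fun z => ENNReal.ofReal (Y / 2 * L ^ (-(Y / 2)) * z ^ (Y / 2 - 1)))

/-- The law of `R = 1 / ((G M + θ̃² ℛ) / 2 + 𝒵)`, where `ℛ` and `𝒵` are independent with laws
`ratioLaw Y` and `zLaw Y L`. -/
def rLaw (G M Y L : ℝ) : Measure ℝ :=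
  ((ratioLaw Y).prod (zLaw Y L)).map
    (fun p => 1 / ((G * M + (thetaTilde G M) ^ 2 * p.1) / 2 + p.2))

/-- A Thorin measure: a Radon measure `U` on `(0, ∞)` with
`∫_{(0,1]} |log x| U(dx) < ∞` and `∫_{(1,∞)} x⁻¹ U(dx) < ∞`. -/
structure IsThorinMeasure (U : Measure ℝ) : Prop where
  support : U (Iic 0) = 0
  radon : ∀ K : Set ℝ, IsCompact K → K ⊆ Ioi 0 → U K < ∞
  near_zero : ∫⁻ x in Ioc 0 1, ENNReal.ofReal |Real.log x| ∂U < ∞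
  at_top : ∫⁻ x in Ioi 1, ENNReal.ofReal x⁻¹ ∂U < ∞

/-- `ρ` is a generalized gamma convolution (without translation term): a probability law on
`[0, ∞)` whose Laplace transform is `exp (-∫ log (1 + u / x) U(dx))` for a Thorin measure `U`. -/
def IsGenGammaConvolution (ρ : Measure ℝ) : Prop :=
  IsProbabilityMeasure ρ ∧ ρ (Iio 0) = 0 ∧
    ∃ U : Measure ℝ, IsThorinMeasure U ∧
      ∀ u : ℝ, 0 ≤ u →
        ∫ x, Real.exp (-u * x) ∂ρ = Real.exp (-∫ x, Real.log (1 + u / x) ∂U)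

end CGMY

end

/-
The Lévy measure of `T t` is that of a generalized gamma convolution: writing `x ^ (-(1 + Y / 2))`
as a gamma integral in `z` turns `t ν(x)` into `x⁻¹ ∫ e^{-a x} U(da)`, where the Thorin measure `U`
is the law of `(G M + θ̃² ℛ) / 2` convolved with `C̃ z ^ (Y / 2 - 1) dz` on `(0, ∞)`. Cutting the
second factor at `z = L` splits `U`, hence the Lévy measure, hence the law of `T t` into a
convolution `μ₁ ∗ μ₂`. The splitting of the random variable `T t` itself is a sample from the
conditional law given the sum, driven by the increment `T (2 t) - T t`, which is independent of
`T t` and has no atoms because the Lévy measure is infinite.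

The cumulants of the remainder are the moments of its Lévy measure, and the `k`-th one is of order
`L ^ (Y / 2 - k)`. So the ratio of the third cumulant to the `3 / 2` power of the variance is
`O(L ^ (-Y / 4))`, and the characteristic functions converge to the Gaussian one.
-/

noncomputable section

namespace CGMY

open scoped Topology

section Laplace

lemma continuous_integral_continuousMap {X : Type*} [TopologicalSpace X] [CompactSpace X]
    [MeasurableSpace X] [BorelSpace X] (μ : Measure X) [IsFiniteMeasure μ] :
    Continuous fun f : C(X, ℝ) => ∫ x, f x ∂μ := by
  have h (f : C(X, ℝ)) : ∫ x, f x ∂μ = ∫ x, ContinuousMap.toLp 1 μ ℝ f x ∂μ :=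
    integral_congr_ae (ContinuousMap.coeFn_toLp μ f).symm
  simp only [h]
  exact continuous_integral.comp (ContinuousMap.toLp 1 μ ℝ).continuous

lemma ext_of_integral_pow_eq {μ ν : Measure unitInterval} [IsFiniteMeasure μ] [IsFiniteMeasure ν]
    (h : ∀ n : ℕ, ∫ x, (x : ℝ) ^ n ∂μ = ∫ x, (x : ℝ) ^ n ∂ν) : μ = ν := by
  have hpoly (p : Polynomial ℝ) : ∫ x : unitInterval, p.eval (x : ℝ) ∂μ =
      ∫ x : unitInterval, p.eval (x : ℝ) ∂ν := by
    have hint (ρ : Measure unitInterval) [IsFiniteMeasure ρ] (n : ℕ) :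
        Integrable (fun x : unitInterval => p.coeff n * (x : ℝ) ^ n) ρ :=
      (by fun_prop : Continuous _).integrable_of_hasCompactSupport (.of_compactSpace _)
    simp only [Polynomial.eval_eq_sum_range]
    rw [integral_finsetSum _ fun n _ => hint μ n, integral_finsetSum _ fun n _ => hint ν n]
    simp only [integral_const_mul, h]
  have hclosed : IsClosed {f : C(unitInterval, ℝ) | ∫ x, f x ∂μ = ∫ x, f x ∂ν} :=
    isClosed_eq (continuous_integral_continuousMap μ) (continuous_integral_continuousMap ν)
  refine ext_of_forall_integral_eq_of_IsFiniteMeasure fun f => ?_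
  have hf : f.toContinuousMap ∈ (polynomialFunctions unitInterval).topologicalClosure := by
    rw [polynomialFunctions_closure_eq_top']; trivial
  refine closure_minimal ?_ hclosed hf
  rintro _ ⟨p, -, rfl⟩
  exact hpoly p

lemma ext_of_laplace {μ ν : Measure ℝ} [IsFiniteMeasure μ] [IsFiniteMeasure ν]
    (hμ : ∀ᵐ x ∂μ, 0 ≤ x) (hν : ∀ᵐ x ∂ν, 0 ≤ x)
    (h : ∀ u : ℝ, 0 ≤ u → ∫ x, Real.exp (-u * x) ∂μ = ∫ x, Real.exp (-u * x) ∂ν) : μ = ν := by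
  let e (x : ℝ) : unitInterval := projIcc 0 1 zero_le_one (Real.exp (-x))
  have he : Measurable e := by fun_prop
  have hl : Measurable fun y : unitInterval => -Real.log y := by fun_prop
  have coe_e {x : ℝ} (hx : 0 ≤ x) : (e x : ℝ) = Real.exp (-x) := by
    rw [coe_projIcc, min_eq_right (Real.exp_le_one_iff.2 (by linarith)),
      max_eq_right (Real.exp_pos _).le]
  have map_map_log {ρ : Measure ℝ} (hρ : ∀ᵐ x ∂ρ, 0 ≤ x) :
      (ρ.map e).map (fun y : unitInterval => -Real.log y) = ρ := by
    rw [Measure.map_map hl he]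
    nth_rw 2 [← Measure.map_id (μ := ρ)]
    refine Measure.map_congr ?_
    filter_upwards [hρ] with x hx
    simp [coe_e hx]
  have moment {ρ : Measure ℝ} (hρ : ∀ᵐ x ∂ρ, 0 ≤ x) (n : ℕ) :
      ∫ y, (y : ℝ) ^ n ∂(ρ.map e) = ∫ x, Real.exp (-(n : ℝ) * x) ∂ρ := by
    rw [integral_map he.aemeasurable (by fun_prop)]
    refine integral_congr_ae ?_
    filter_upwards [hρ] with x hx
    rw [coe_e hx, ← Real.exp_nat_mul]
    ring_nf
  rw [← map_map_log hμ, ← map_map_log hν]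
  congr 1
  exact ext_of_integral_pow_eq fun n => by rw [moment hμ, moment hν, h n n.cast_nonneg]

end Laplace

section SubordinatorLevyMeasure

lemma one_sub_exp_neg_nonneg {x : ℝ} (hx : 0 ≤ x) : 0 ≤ 1 - Real.exp (-x) :=
  sub_nonneg.2 (Real.exp_le_one_iff.2 (neg_nonpos.2 hx))

lemma min_one_le_two_mul_one_sub_exp {x : ℝ} (hx : 0 ≤ x) :
    min 1 x ≤ 2 * (1 - Real.exp (-x)) := by
  have hexp : Real.exp (-x) ≤ 1 - x / (1 + x) := by
    rw [one_sub_div (by positivity), add_sub_cancel_right, one_div, Real.exp_neg]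
    exact inv_anti₀ (by positivity) (by linarith [Real.add_one_le_exp x])
  have hmin : min 1 x ≤ 2 * (x / (1 + x)) := by
    rw [← mul_div_assoc, le_div_iff₀ (by positivity)]
    rcases le_total 1 x with h | h
    · rw [min_eq_left h]; linarith
    · rw [min_eq_right h]; nlinarith
  linarith

lemma norm_cexp_mul_le_one {z : ℂ} (hz : z.re ≤ 0) {x : ℝ} (hx : 0 ≤ x) :
    ‖Complex.exp (z * x)‖ ≤ 1 := by
  rw [Complex.norm_exp, Complex.re_mul_ofReal]
  exact Real.exp_le_one_iff.2 (mul_nonpos_of_nonpos_of_nonneg hz hx)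

lemma norm_cexp_sub_one_le {z : ℂ} (hz : z.re ≤ 0) {x : ℝ} (hx : 0 ≤ x) :
    ‖Complex.exp (z * x) - 1‖ ≤ 4 * (1 + ‖z‖) * (1 - Real.exp (-x)) := by
  have hmin := min_one_le_two_mul_one_sub_exp hx
  have hexp := one_sub_exp_neg_nonneg hx
  have hz0 := norm_nonneg z
  have hnorm : ‖z * (x : ℂ)‖ = ‖z‖ * x := by
    rw [norm_mul, Complex.norm_real, Real.norm_of_nonneg hx]
  have htwo : ‖Complex.exp (z * x) - 1‖ ≤ 2 := by
    refine (norm_sub_le _ _).trans ?_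
    rw [norm_one]
    linarith [norm_cexp_mul_le_one hz hx]
  rcases le_total 1 x with h | h
  · rw [min_eq_left h] at hmin
    nlinarith
  rw [min_eq_right h] at hmin
  rcases le_total 1 (‖z‖ * x) with h' | h'
  · nlinarith
  · have := Complex.norm_exp_sub_one_le (x := z * x) (by rwa [hnorm])
    rw [hnorm] at this
    nlinarith

/-- The Lévy measure of a driftless subordinator: a measure on `(0, ∞)` that integrates
`min 1 x`. The equivalent integrand `1 - e^{-x}` is the one met in Laplace exponents. -/
structure IsSubordinatorLevyMeasure (Λ : Measure ℝ) : Prop where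
  ae_pos : ∀ᵐ x ∂Λ, 0 < x
  lintegral_lt_top : ∫⁻ x, ENNReal.ofReal (1 - Real.exp (-x)) ∂Λ < ∞

namespace IsSubordinatorLevyMeasure

variable {Λ Λ' : Measure ℝ}

lemma ae_nonneg (h : IsSubordinatorLevyMeasure Λ) : ∀ᵐ x ∂Λ, 0 ≤ x :=
  h.ae_pos.mono fun _ => le_of_lt

lemma mono (h : IsSubordinatorLevyMeasure Λ) (hle : Λ' ≤ Λ) : IsSubordinatorLevyMeasure Λ' where
  ae_pos := ae_mono hle h.ae_pos
  lintegral_lt_top := (lintegral_mono' hle le_rfl).trans_lt h.lintegral_lt_top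

lemma add (h : IsSubordinatorLevyMeasure Λ) (h' : IsSubordinatorLevyMeasure Λ') :
    IsSubordinatorLevyMeasure (Λ + Λ') where
  ae_pos := ae_add_measure_iff.2 ⟨h.ae_pos, h'.ae_pos⟩
  lintegral_lt_top := by
    rw [lintegral_add_measure]
    exact ENNReal.add_lt_top.2 ⟨h.lintegral_lt_top, h'.lintegral_lt_top⟩

lemma of_isFiniteMeasure [IsFiniteMeasure Λ] (h : ∀ᵐ x ∂Λ, 0 < x) :
    IsSubordinatorLevyMeasure Λ where
  ae_pos := h
  lintegral_lt_top := by
    have hle (x : ℝ) : ENNReal.ofReal (1 - Real.exp (-x)) ≤ 1 :=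
      ENNReal.ofReal_le_one.2 (by linarith [Real.exp_pos (-x)])
    exact (lintegral_mono hle).trans_lt (by simp)

lemma integrable_one_sub_exp (h : IsSubordinatorLevyMeasure Λ) :
    Integrable (fun x => 1 - Real.exp (-x)) Λ :=
  ⟨by fun_prop, (hasFiniteIntegral_iff_ofReal (h.ae_nonneg.mono fun _ => one_sub_exp_neg_nonneg)).2
    h.lintegral_lt_top⟩

lemma integrable_cexp_sub_one (h : IsSubordinatorLevyMeasure Λ) {z : ℂ} (hz : z.re ≤ 0) :
    Integrable (fun x : ℝ => Complex.exp (z * x) - 1) Λ := by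
  refine (h.integrable_one_sub_exp.const_mul (4 * (1 + ‖z‖))).mono' (by fun_prop) ?_
  filter_upwards [h.ae_nonneg] with x hx using norm_cexp_sub_one_le hz hx

end IsSubordinatorLevyMeasure

lemma integrable_cexp_mul {μ : Measure ℝ} [IsFiniteMeasure μ] (h : ∀ᵐ x ∂μ, 0 ≤ x) {z : ℂ}
    (hz : z.re ≤ 0) : Integrable (fun x : ℝ => Complex.exp (z * x)) μ := by
  refine Integrable.of_bound (by fun_prop) 1 ?_
  filter_upwards [h] with x hx using norm_cexp_mul_le_one hz hx

lemma ae_nonneg_conv {μ ν : Measure ℝ} (hμ : ∀ᵐ x ∂μ, 0 ≤ x)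
    (hν : ∀ᵐ x ∂ν, 0 ≤ x) : ∀ᵐ x ∂(μ ∗ ν), 0 ≤ x := by
  rw [Measure.conv, ae_map_iff (by fun_prop) measurableSet_Ici]
  filter_upwards [Measure.quasiMeasurePreserving_fst.ae hμ,
    Measure.quasiMeasurePreserving_snd.ae hν] with p hp hq using add_nonneg hp hq

lemma integral_cexp_mul_conv {μ ν : Measure ℝ} [IsFiniteMeasure μ] [IsFiniteMeasure ν]
    (hμ : ∀ᵐ x ∂μ, 0 ≤ x) (hν : ∀ᵐ x ∂ν, 0 ≤ x) {z : ℂ} (hz : z.re ≤ 0) :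
    ∫ x : ℝ, Complex.exp (z * x) ∂(μ ∗ ν) =
      (∫ x : ℝ, Complex.exp (z * x) ∂μ) * ∫ x : ℝ, Complex.exp (z * x) ∂ν := by
  rw [integral_conv (integrable_cexp_mul (ae_nonneg_conv hμ hν) hz)]
  simp_rw [Complex.ofReal_add, mul_add, Complex.exp_add, integral_const_mul]
  rw [integral_mul_const]

/-- `μ` is the driftless infinitely divisible law on `[0, ∞)` with Lévy measure `Λ`. The
Lévy–Khintchine formula is required on the whole half-plane `Re z ≤ 0`, so that it gives both the
Laplace transform and the characteristic function. -/
structure HasLevyMeasure (μ Λ : Measure ℝ) : Prop where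
  levy : IsSubordinatorLevyMeasure Λ
  prob : IsProbabilityMeasure μ
  nonneg : ∀ᵐ x ∂μ, 0 ≤ x
  transform : ∀ z : ℂ, z.re ≤ 0 →
    ∫ x : ℝ, Complex.exp (z * x) ∂μ = Complex.exp (∫ x : ℝ, (Complex.exp (z * x) - 1) ∂Λ)

namespace HasLevyMeasure

variable {μ ν Λ Λ' : Measure ℝ}

lemma laplace (h : HasLevyMeasure μ Λ) {u : ℝ} (hu : 0 ≤ u) :
    ∫ x, Real.exp (-u * x) ∂μ = Real.exp (-∫ x, (1 - Real.exp (-u * x)) ∂Λ) := by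
  have hleft : ∫ x : ℝ, Complex.exp ((-u : ℝ) * x) ∂μ =
      ((∫ x, Real.exp (-u * x) ∂μ : ℝ) : ℂ) := by
    rw [← integral_complex_ofReal]; simp
  have hright : ∫ x : ℝ, (Complex.exp ((-u : ℝ) * x) - 1) ∂Λ =
      ((-∫ x, (1 - Real.exp (-u * x)) ∂Λ : ℝ) : ℂ) := by
    rw [← integral_neg, ← integral_complex_ofReal]; simp
  have htransform := h.transform (-u : ℝ) (by simpa using hu)
  rw [hleft, hright, ← Complex.ofReal_exp] at htransform
  exact_mod_cast htransform

lemma charFun_eq (h : HasLevyMeasure μ Λ) (s : ℝ) :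
    charFun μ s = Complex.exp (∫ x : ℝ, (Complex.exp (s * x * Complex.I) - 1) ∂Λ) := by
  have htransform := h.transform (s * Complex.I) (by simp)
  simp only [mul_right_comm _ Complex.I] at htransform
  rw [charFun_apply_real, htransform]

lemma unique (h : HasLevyMeasure μ Λ) (h' : HasLevyMeasure ν Λ) : μ = ν := by
  have := h.prob
  have := h'.prob
  exact Measure.ext_of_charFun (funext fun s => by rw [h.charFun_eq, h'.charFun_eq])

lemma conv (h : HasLevyMeasure μ Λ) (h' : HasLevyMeasure ν Λ') :
    HasLevyMeasure (μ ∗ ν) (Λ + Λ') := by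
  have := h.prob
  have := h'.prob
  refine ⟨h.levy.add h'.levy, inferInstance, ae_nonneg_conv h.nonneg h'.nonneg, fun z hz => ?_⟩
  rw [integral_cexp_mul_conv h.nonneg h'.nonneg hz, h.transform z hz, h'.transform z hz,
    integral_add_measure (h.levy.integrable_cexp_sub_one hz) (h'.levy.integrable_cexp_sub_one hz),
    Complex.exp_add]

lemma dirac_zero : HasLevyMeasure (Measure.dirac 0) 0 where
  levy := .of_isFiniteMeasure (by simp)
  prob := inferInstance
  nonneg := by rw [ae_dirac_iff measurableSet_Ici]
  transform z _ := by simp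

end HasLevyMeasure

end SubordinatorLevyMeasure

section CompoundPoisson

lemma conv_singleton_le {μ ν : Measure ℝ} [SFinite μ] [SFinite ν] {b : ℝ≥0∞}
    (h : ∀ x, μ {x} ≤ b) (c : ℝ) : (μ ∗ ν) {c} ≤ b * ν univ := by
  rw [Measure.conv, Measure.map_apply (by fun_prop) (measurableSet_singleton c),
    Measure.prod_apply_symm ((measurableSet_singleton c).preimage (by fun_prop)),
    ← lintegral_const]
  refine lintegral_mono fun y => (measure_mono fun x hx => ?_).trans (h (c - y))
  exact eq_sub_of_add_eq hx

/-- The `n`-fold convolution power of a measure. -/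
def convPow (ρ : Measure ℝ) : ℕ → Measure ℝ
  | 0 => Measure.dirac 0
  | n + 1 => ρ ∗ convPow ρ n

/-- The law of the sum of a Poisson number of independent variables, with Lévy measure `ρ`; both
the intensity and the jump law are read off the finite measure `ρ`. -/
def compoundPoisson (ρ : Measure ℝ) : Measure ℝ :=
  ENNReal.ofReal (Real.exp (-(ρ.real univ))) •
    Measure.sum fun n : ℕ => ENNReal.ofReal ((n.factorial : ℝ)⁻¹) • convPow ρ n

variable {ρ : Measure ℝ}

lemma ae_nonneg_convPow (hρ : ∀ᵐ x ∂ρ, 0 ≤ x) (n : ℕ) : ∀ᵐ x ∂(convPow ρ n), 0 ≤ x := by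
  induction n with
  | zero => rw [convPow, ae_dirac_iff measurableSet_Ici]
  | succ n ih => exact ae_nonneg_conv hρ ih

lemma ae_nonneg_compoundPoisson (hρ : ∀ᵐ x ∂ρ, 0 ≤ x) : ∀ᵐ x ∂(compoundPoisson ρ), 0 ≤ x :=
  Measure.ae_smul_measure
    (Measure.ae_sum_iff.2 fun n => Measure.ae_smul_measure (ae_nonneg_convPow hρ n) _) _

variable [IsFiniteMeasure ρ]

instance isFiniteMeasure_convPow (n : ℕ) : IsFiniteMeasure (convPow ρ n) := by
  induction n with
  | zero => unfold convPow; infer_instance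
  | succ n ih => unfold convPow; infer_instance

lemma integral_cexp_mul_convPow (hρ : ∀ᵐ x ∂ρ, 0 ≤ x) {z : ℂ} (hz : z.re ≤ 0) (n : ℕ) :
    ∫ x : ℝ, Complex.exp (z * x) ∂(convPow ρ n) = (∫ x : ℝ, Complex.exp (z * x) ∂ρ) ^ n := by
  induction n with
  | zero => simp [convPow]
  | succ n ih =>
    rw [convPow, integral_cexp_mul_conv hρ (ae_nonneg_convPow hρ n) hz, ih, pow_succ']

lemma convPow_univ (n : ℕ) : convPow ρ n univ = ρ univ ^ n := by
  induction n with
  | zero => simp [convPow]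
  | succ n ih =>
    rw [convPow, Measure.conv, Measure.map_apply (by fun_prop) MeasurableSet.univ, preimage_univ,
      ← univ_prod_univ, Measure.prod_prod, ih, pow_succ']

instance isProbabilityMeasure_compoundPoisson : IsProbabilityMeasure (compoundPoisson ρ) := by
  have hexp : HasSum (fun n : ℕ => ρ.real univ ^ n / n.factorial) (Real.exp (ρ.real univ)) := by
    rw [Real.exp_eq_exp_ℝ]
    exact NormedSpace.expSeries_div_hasSum_exp _
  have hterm (n : ℕ) : ENNReal.ofReal ((n.factorial : ℝ)⁻¹) * ρ univ ^ n =
      ENNReal.ofReal (ρ.real univ ^ n / n.factorial) := by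
    rw [← ofReal_measureReal, ← ENNReal.ofReal_pow measureReal_nonneg,
      ← ENNReal.ofReal_mul (by positivity), inv_mul_eq_div]
  constructor
  simp only [compoundPoisson, Measure.smul_apply, Measure.sum_apply _ MeasurableSet.univ,
    convPow_univ, smul_eq_mul, hterm]
  rw [← ENNReal.ofReal_tsum_of_nonneg (fun n => by positivity) hexp.summable,
    hexp.tsum_eq, ← ENNReal.ofReal_mul (Real.exp_pos _).le, ← Real.exp_add]
  simp

lemma integral_cexp_mul_compoundPoisson (hρ : ∀ᵐ x ∂ρ, 0 ≤ x) {z : ℂ} (hz : z.re ≤ 0) :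
    ∫ x : ℝ, Complex.exp (z * x) ∂(compoundPoisson ρ) =
      Complex.exp (∫ x : ℝ, (Complex.exp (z * x) - 1) ∂ρ) := by
  have hseries : HasSum (fun n : ℕ => (∫ x : ℝ, Complex.exp (z * x) ∂ρ) ^ n / n.factorial)
      (Complex.exp (∫ x : ℝ, Complex.exp (z * x) ∂ρ)) := by
    rw [Complex.exp_eq_exp_ℂ]
    exact NormedSpace.expSeries_div_hasSum_exp _
  have hint : Integrable (fun x : ℝ => Complex.exp (z * x))
      (Measure.sum fun n : ℕ => ENNReal.ofReal ((n.factorial : ℝ)⁻¹) • convPow ρ n) :=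
    (integrable_smul_measure (by simp [Real.exp_pos]) ENNReal.ofReal_ne_top).1
      (integrable_cexp_mul (ae_nonneg_compoundPoisson hρ) hz)
  have hsum := (hasSum_integral_measure hint).unique (by
    convert! hseries using 2 with n
    rw [integral_smul_measure, ENNReal.toReal_ofReal (by positivity),
      integral_cexp_mul_convPow hρ hz, Complex.real_smul, Complex.ofReal_inv,
      Complex.ofReal_natCast, div_eq_inv_mul])
  rw [compoundPoisson, integral_smul_measure, hsum, ENNReal.toReal_ofReal (Real.exp_pos _).le,
    integral_sub (integrable_cexp_mul hρ hz) (integrable_const _), sub_eq_neg_add,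
    Complex.exp_add, Complex.real_smul, integral_const, Complex.real_smul, mul_one,
    Complex.ofReal_exp, Complex.ofReal_neg]

lemma hasLevyMeasure_compoundPoisson (hρ : ∀ᵐ x ∂ρ, 0 < x) :
    HasLevyMeasure (compoundPoisson ρ) ρ :=
  have hρ' := hρ.mono fun _ => le_of_lt
  ⟨.of_isFiniteMeasure hρ, inferInstance, ae_nonneg_compoundPoisson hρ',
    fun _ => integral_cexp_mul_compoundPoisson hρ'⟩

lemma compoundPoisson_singleton_le (h : ∀ x, ρ {x} = 0) (c : ℝ) :
    compoundPoisson ρ {c} ≤ ENNReal.ofReal (Real.exp (-(ρ.real univ))) := by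
  have hsucc (n : ℕ) : convPow ρ (n + 1) {c} = 0 := by
    simpa [convPow] using conv_singleton_le (ν := convPow ρ n) (fun x => (h x).le) c
  rw [compoundPoisson, Measure.smul_apply, Measure.sum_apply _ (measurableSet_singleton c),
    tsum_eq_single 0]
  · refine mul_le_of_le_one_right' ?_
    simpa [convPow] using (prob_le_one : Measure.dirac (0 : ℝ) {c} ≤ 1)
  · rintro (_ | n) hn
    · exact absurd rfl hn
    · simp [hsucc n]

end CompoundPoisson

section Existence

lemma summable_of_tsum_one_sub_exp {f : ℕ → ℝ} (hf : ∀ n, 0 ≤ f n)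
    (h : ∑' n, ENNReal.ofReal (1 - Real.exp (-f n)) ≠ ∞) : Summable f := by
  have hexp : Summable fun n => 1 - Real.exp (-f n) := by
    simpa [ENNReal.toReal_ofReal (one_sub_exp_neg_nonneg (hf _))] using ENNReal.summable_toReal h
  have hlim : Tendsto (fun n => 2 * (1 - Real.exp (-f n))) atTop (𝓝 0) := by
    simpa using hexp.tendsto_atTop_zero.const_mul 2
  refine Summable.of_norm_bounded_eventually_nat (hexp.mul_left 2) ?_
  filter_upwards [hlim.eventually_lt_const one_pos] with n hn
  rw [Real.norm_of_nonneg (hf n)]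
  rcases min_le_iff.1 (min_one_le_two_mul_one_sub_exp (hf n)) with h' | h'
  · exact absurd (h'.trans_lt hn) (lt_irrefl _)
  · exact h'

lemma HasLevyMeasure.lintegral_one_sub_exp_le {μ Λ : Measure ℝ} (h : HasLevyMeasure μ Λ) :
    ∫⁻ x, ENNReal.ofReal (1 - Real.exp (-x)) ∂μ ≤ ∫⁻ x, ENNReal.ofReal (1 - Real.exp (-x)) ∂Λ := by
  have := h.prob
  have hint : Integrable (fun x => Real.exp (-x)) μ := by
    refine Integrable.of_bound (by fun_prop) 1 ?_
    filter_upwards [h.nonneg] with x hx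
    rw [Real.norm_of_nonneg (Real.exp_pos _).le]
    exact Real.exp_le_one_iff.2 (neg_nonpos.2 hx)
  have hlaplace : ∫ x, Real.exp (-x) ∂μ = Real.exp (-∫ x, (1 - Real.exp (-x)) ∂Λ) := by
    simpa using h.laplace zero_le_one
  rw [← ofReal_integral_eq_lintegral_ofReal (f := fun x => 1 - Real.exp (-x))
      ((integrable_const 1).sub hint) (h.nonneg.mono fun _ => one_sub_exp_neg_nonneg),
    ← ofReal_integral_eq_lintegral_ofReal h.levy.integrable_one_sub_exp
      (h.levy.ae_nonneg.mono fun _ => one_sub_exp_neg_nonneg)]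
  refine ENNReal.ofReal_le_ofReal ?_
  rw [integral_sub (integrable_const _) hint, hlaplace, integral_const, probReal_univ, one_smul]
  linarith [Real.add_one_le_exp (-∫ x, (1 - Real.exp (-x)) ∂Λ)]

lemma HasLevyMeasure.ae_nonneg {Ω : Type*} [MeasurableSpace Ω] {P : Measure Ω} {X : Ω → ℝ}
    {Λ : Measure ℝ} (h : HasLevyMeasure (P.map X) Λ) (hX : Measurable X) : ∀ᵐ ω ∂P, 0 ≤ X ω :=
  ae_of_ae_map hX.aemeasurable h.nonneg

section Sum

variable {Ω : Type*} [MeasurableSpace Ω] {P : Measure Ω} {X : ℕ → Ω → ℝ}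
  {Λ : ℕ → Measure ℝ}

lemma ae_summable_of_hasLevyMeasure (hX : ∀ n, Measurable (X n))
    (h : ∀ n, HasLevyMeasure (P.map (X n)) (Λ n))
    (hΛ : IsSubordinatorLevyMeasure (Measure.sum Λ)) : ∀ᵐ ω ∂P, Summable fun n => X n ω := by
  have hmeas (n : ℕ) : Measurable fun ω => ENNReal.ofReal (1 - Real.exp (-X n ω)) := by fun_prop
  have hle (n : ℕ) : ∫⁻ ω, ENNReal.ofReal (1 - Real.exp (-X n ω)) ∂P ≤
      ∫⁻ x, ENNReal.ofReal (1 - Real.exp (-x)) ∂(Λ n) := by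
    rw [← lintegral_map (f := fun x => ENNReal.ofReal (1 - Real.exp (-x))) (by fun_prop) (hX n)]
    exact (h n).lintegral_one_sub_exp_le
  have hfin : ∫⁻ ω, ∑' n, ENNReal.ofReal (1 - Real.exp (-X n ω)) ∂P < ∞ := by
    rw [lintegral_tsum fun n => (hmeas n).aemeasurable]
    refine (ENNReal.tsum_le_tsum hle).trans_lt ?_
    simpa [lintegral_sum_measure] using hΛ.lintegral_lt_top
  filter_upwards [ae_lt_top (Measurable.tsum hmeas) hfin.ne,
    ae_all_iff.2 fun n => (h n).ae_nonneg (hX n)] with ω hω hω0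
  exact summable_of_tsum_one_sub_exp hω0 hω.ne

variable [IsProbabilityMeasure P]

lemma hasLevyMeasure_map_sum (hX : ∀ n, Measurable (X n)) (hindep : iIndepFun X P)
    (h : ∀ n, HasLevyMeasure (P.map (X n)) (Λ n)) (s : Finset ℕ) :
    HasLevyMeasure (P.map (∑ n ∈ s, X n)) (∑ n ∈ s, Λ n) := by
  induction s using Finset.induction_on with
  | empty => simpa [Pi.zero_def, Measure.map_const] using HasLevyMeasure.dirac_zero
  | insert n s hn ih =>
    rw [Finset.sum_insert hn, Finset.sum_insert hn,
      (hindep.indepFun_finsetSum_of_notMem hX hn).symm.map_add_eq_map_conv_map (hX n)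
        (by fun_prop)]
    exact (h n).conv ih

lemma hasLevyMeasure_map_tsum (hX : ∀ n, Measurable (X n)) (hindep : iIndepFun X P)
    (h : ∀ n, HasLevyMeasure (P.map (X n)) (Λ n))
    (hΛ : IsSubordinatorLevyMeasure (Measure.sum Λ)) :
    HasLevyMeasure (P.map fun ω => ∑' n, X n ω) (Measure.sum Λ) := by
  have hpos : ∀ᵐ ω ∂P, ∀ n, 0 ≤ X n ω :=
    ae_all_iff.2 fun n => (h n).ae_nonneg (hX n)
  have hsumm := ae_summable_of_hasLevyMeasure hX h hΛ
  have hmeas : Measurable fun ω => ∑' n, X n ω := by fun_prop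
  refine ⟨hΛ, Measure.isProbabilityMeasure_map hmeas.aemeasurable, ?_, fun z hz => ?_⟩
  · rw [ae_map_iff hmeas.aemeasurable measurableSet_Ici]
    filter_upwards [hpos] with ω hω using tsum_nonneg hω
  have hpartial (N : ℕ) :
      ∫ ω, Complex.exp (z * ((∑ n ∈ Finset.range N, X n ω : ℝ) : ℂ)) ∂P =
        Complex.exp (∑ n ∈ Finset.range N, ∫ x : ℝ, (Complex.exp (z * x) - 1) ∂(Λ n)) := by
    have hN := hasLevyMeasure_map_sum hX hindep h (Finset.range N)
    rw [← integral_finsetSum_measure fun n _ => (h n).levy.integrable_cexp_sub_one hz,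
      ← hN.transform z hz, integral_map (by fun_prop) (by fun_prop)]
    simp only [Finset.sum_apply]
  have hlim : Tendsto
      (fun N => ∫ ω, Complex.exp (z * ((∑ n ∈ Finset.range N, X n ω : ℝ) : ℂ)) ∂P) atTop
      (𝓝 (∫ ω, Complex.exp (z * ((∑' n, X n ω : ℝ) : ℂ)) ∂P)) := by
    refine tendsto_integral_of_dominated_convergence (fun _ => 1) (fun N => by fun_prop)
      (integrable_const _) (fun N => ?_) ?_
    · filter_upwards [hpos] with ω hω
      exact norm_cexp_mul_le_one hz (Finset.sum_nonneg fun n _ => hω n)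
    · filter_upwards [hsumm] with ω hω
      exact ((by fun_prop : Continuous fun x : ℝ => Complex.exp (z * x)).tendsto _).comp
        hω.hasSum.tendsto_sum_nat
  simp only [hpartial] at hlim
  rw [integral_map hmeas.aemeasurable (by fun_prop)]
  refine tendsto_nhds_unique hlim ((Complex.continuous_exp.tendsto _).comp ?_)
  exact (hasSum_integral_measure (hΛ.integrable_cexp_sub_one hz)).tendsto_sum_nat

end Sum

/-- Every Lévy measure is a sum of finite ones, so the law is that of a convergent series of
independent compound Poisson variables. -/
theorem exists_hasLevyMeasure {Λ : Measure ℝ} [SFinite Λ] (hΛ : IsSubordinatorLevyMeasure Λ) :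
    ∃ μ, HasLevyMeasure μ Λ := by
  have hpiece (n : ℕ) : HasLevyMeasure (compoundPoisson (sfiniteSeq Λ n)) (sfiniteSeq Λ n) :=
    hasLevyMeasure_compoundPoisson (hΛ.mono (sfiniteSeq_le Λ n)).ae_pos
  let Q := Measure.infinitePi fun n => compoundPoisson (sfiniteSeq Λ n)
  have heval (n : ℕ) : Q.map (fun ω => ω n) = compoundPoisson (sfiniteSeq Λ n) :=
    Measure.infinitePi_map_eval _ n
  have hlevy := hasLevyMeasure_map_tsum (P := Q) (X := fun n ω => ω n) measurable_pi_apply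
    (iIndepFun_infinitePi (X := fun _ x => x) fun _ => measurable_id)
    (fun n => heval n ▸ hpiece n) (by rwa [sum_sfiniteSeq])
  exact ⟨_, sum_sfiniteSeq Λ ▸ hlevy⟩

end Existence

section NoAtoms

lemma exists_isFiniteMeasure_add_eq {α : Type*} [MeasurableSpace α] (Λ : Measure α) [SFinite Λ]
    {b : ℝ≥0∞} (hb : b < Λ univ) :
    ∃ Λ₁ Λ₂ : Measure α, IsFiniteMeasure Λ₁ ∧ SFinite Λ₂ ∧ Λ₁ + Λ₂ = Λ ∧ b < Λ₁ univ := by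
  have hsum : HasSum (fun n => sfiniteSeq Λ n univ) (Λ univ) := by
    convert! ENNReal.summable.hasSum
    rw [← Measure.sum_apply _ MeasurableSet.univ, sum_sfiniteSeq]
  obtain ⟨s, hs⟩ := (hsum.eventually (lt_mem_nhds hb)).exists
  refine ⟨∑ n ∈ s, sfiniteSeq Λ n, Measure.sum fun n : ↥(s : Set ℕ)ᶜ => sfiniteSeq Λ n,
    inferInstance, inferInstance, ?_, by simpa using hs⟩
  rw [← Measure.sum_coe_finset]
  exact (Measure.sum_add_sum_compl (s : Set ℕ) _).trans (sum_sfiniteSeq Λ)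

/-- Splitting off a compound Poisson component of large intensity `M` from the law leaves atoms of
mass at most `e^{-M}`. -/
lemma HasLevyMeasure.measure_singleton_eq_zero {μ Λ : Measure ℝ} [SFinite Λ]
    (h : HasLevyMeasure μ Λ) (hatom : ∀ x, Λ {x} = 0) (htop : Λ univ = ∞) (c : ℝ) :
    μ {c} = 0 := by
  have hle (M : ℝ) : μ {c} ≤ ENNReal.ofReal (Real.exp (-M)) := by
    obtain ⟨Λ₁, Λ₂, _, _, hadd, hM⟩ := exists_isFiniteMeasure_add_eq Λ
      (b := ENNReal.ofReal M) (by rw [htop]; exact ENNReal.ofReal_lt_top)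
    obtain ⟨hle₁, hle₂⟩ : Λ₁ ≤ Λ ∧ Λ₂ ≤ Λ := by
      rw [← hadd]; exact ⟨Measure.le_add_right le_rfl, Measure.le_add_left le_rfl⟩
    have hM' : M ≤ Λ₁.real univ := (ENNReal.ofReal_le_iff_le_toReal (measure_ne_top _ _)).1 hM.le
    have hatom₁ (x : ℝ) : Λ₁ {x} = 0 := le_zero_iff.1 ((hle₁ _).trans (hatom x).le)
    obtain ⟨μ₂, hμ₂⟩ := exists_hasLevyMeasure (h.levy.mono hle₂)
    have := hμ₂.prob
    have hconv := (hasLevyMeasure_compoundPoisson (h.levy.mono hle₁).ae_pos).conv hμ₂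
    rw [hadd] at hconv
    rw [h.unique hconv]
    refine (conv_singleton_le (compoundPoisson_singleton_le hatom₁) c).trans ?_
    rw [measure_univ, mul_one]
    exact ENNReal.ofReal_le_ofReal (Real.exp_le_exp.2 (neg_le_neg hM'))
  have hlim : Tendsto (fun M : ℝ => ENNReal.ofReal (Real.exp (-M))) atTop (𝓝 0) := by
    simpa using ENNReal.tendsto_ofReal Real.tendsto_exp_neg_atTop_nhds_zero
  exact le_zero_iff.1 (ge_of_tendsto' hlim hle)

end NoAtoms

section Moments

lemma tendsto_exp_sub_one_div {ι : Type*} {l : Filter ι} {p v : ι → ℝ} {m : ℝ}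
    (hp : Tendsto p l (𝓝 0)) (hpv : Tendsto (fun i => p i / v i) l (𝓝 m)) :
    Tendsto (fun i => (Real.exp (p i) - 1) / v i) l (𝓝 m) := by
  have hslope : Tendsto (fun i => dslope Real.exp 0 (p i)) l (𝓝 1) := by
    have hcont : ContinuousAt (dslope Real.exp 0) 0 :=
      continuousAt_dslope_same.2 Real.differentiableAt_exp
    simpa [Function.comp_def] using hcont.tendsto.comp hp
  have hmul := hslope.mul hpv
  rw [one_mul] at hmul
  refine hmul.congr fun i => ?_
  have := sub_smul_dslope Real.exp 0 (p i)
  rw [sub_zero, smul_eq_mul, Real.exp_zero] at this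
  rw [← this]
  ring

/-- The function `(1 - e^{-ux}) / u`, which is bounded on `[0, ∞)` and increases to `x` as
`u ↓ 0`. Its moments under an infinitely divisible law are read off the Laplace transform. -/
def expApprox (u x : ℝ) : ℝ := (1 - Real.exp (-u * x)) / u

lemma expApprox_nonneg {u x : ℝ} (hu : 0 < u) (hx : 0 ≤ x) : 0 ≤ expApprox u x := by
  rw [expApprox, neg_mul]
  exact div_nonneg (one_sub_exp_neg_nonneg (by positivity)) hu.le

lemma expApprox_le {u x : ℝ} (hu : 0 < u) : expApprox u x ≤ x := by
  rw [expApprox, div_le_iff₀ hu]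
  linarith [Real.add_one_le_exp (-u * x)]

lemma expApprox_le_one_div {u x : ℝ} (hu : 0 < u) : expApprox u x ≤ 1 / u :=
  div_le_div_of_nonneg_right (by linarith [Real.exp_pos (-u * x)]) hu.le

lemma measurable_expApprox (u : ℝ) : Measurable (expApprox u) := by
  unfold expApprox; fun_prop

lemma tendsto_expApprox (x : ℝ) : Tendsto (fun u => expApprox u x) (𝓝[>] 0) (𝓝 x) := by
  have hderiv : HasDerivAt (fun u : ℝ => 1 - Real.exp (-u * x)) x 0 := by
    simpa using (((hasDerivAt_id (0 : ℝ)).neg.mul_const x).exp).const_sub 1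
  refine (hderiv.tendsto_slope.mono_left (nhdsWithin_mono 0 fun u hu => ne_of_gt hu)).congr
    fun u => ?_
  simp [slope_def_field, expApprox]

lemma tendsto_integral_expApprox {μ : Measure ℝ} (hμ : ∀ᵐ x ∂μ, 0 ≤ x) (k : ℕ)
    (hint : Integrable (fun x => x ^ k) μ) :
    Tendsto (fun u => ∫ x, expApprox u x ^ k ∂μ) (𝓝[>] 0) (𝓝 (∫ x, x ^ k ∂μ)) := by
  refine tendsto_integral_filter_of_dominated_convergence (fun x => x ^ k)
    (.of_forall fun u => ((measurable_expApprox u).pow_const k).aestronglyMeasurable) ?_ hint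
    (ae_of_all _ fun x => (tendsto_expApprox x).pow k)
  filter_upwards [self_mem_nhdsWithin] with u hu
  filter_upwards [hμ] with x hx
  rw [Real.norm_of_nonneg (pow_nonneg (expApprox_nonneg hu hx) k)]
  exact pow_le_pow_left₀ (expApprox_nonneg hu hx) (expApprox_le hu) k

lemma integrable_expApprox_pow {μ : Measure ℝ} [IsFiniteMeasure μ] (hμ : ∀ᵐ x ∂μ, 0 ≤ x) {u : ℝ}
    (hu : 0 < u) (k : ℕ) : Integrable (fun x => expApprox u x ^ k) μ := by
  refine Integrable.of_bound ((measurable_expApprox u).pow_const k).aestronglyMeasurable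
    ((1 / u) ^ k) ?_
  filter_upwards [hμ] with x hx
  rw [Real.norm_of_nonneg (pow_nonneg (expApprox_nonneg hu hx) k)]
  exact pow_le_pow_left₀ (expApprox_nonneg hu hx) (expApprox_le_one_div hu) k

lemma integrable_pow_of_tendsto_expApprox {μ : Measure ℝ} [IsFiniteMeasure μ]
    (hμ : ∀ᵐ x ∂μ, 0 ≤ x) {k : ℕ} {m : ℝ}
    (hlim : Tendsto (fun u => ∫ x, expApprox u x ^ k ∂μ) (𝓝[>] 0) (𝓝 m)) :
    Integrable (fun x => x ^ k) μ := by
  obtain ⟨u, hu⟩ := exists_seq_tendsto (𝓝[>] (0 : ℝ))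
  have hu0 : ∀ᶠ n in atTop, 0 < u n := hu.eventually self_mem_nhdsWithin
  refine ⟨by fun_prop,
    (hasFiniteIntegral_iff_ofReal (hμ.mono fun x hx => pow_nonneg hx k)).2 ?_⟩
  calc ∫⁻ x, ENNReal.ofReal (x ^ k) ∂μ
      = ∫⁻ x, liminf (fun n => ENNReal.ofReal (expApprox (u n) x ^ k)) atTop ∂μ :=
        lintegral_congr fun x => (ENNReal.tendsto_ofReal
          (((tendsto_expApprox x).comp hu).pow k)).liminf_eq.symm
    _ ≤ liminf (fun n => ∫⁻ x, ENNReal.ofReal (expApprox (u n) x ^ k) ∂μ) atTop :=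
        lintegral_liminf_le fun n => ((measurable_expApprox _).pow_const k).ennreal_ofReal
    _ = ENNReal.ofReal m := by
        refine ((ENNReal.tendsto_ofReal (hlim.comp hu)).congr' ?_).liminf_eq
        filter_upwards [hu0] with n hn
        exact ofReal_integral_eq_lintegral_ofReal (integrable_expApprox_pow hμ hn k)
          (hμ.mono fun x hx => pow_nonneg (expApprox_nonneg hn hx) k)
    _ < ∞ := ENNReal.ofReal_lt_top

section LaplaceExponent

/-- The Laplace exponent of the driftless subordinator with Lévy measure `Λ`. -/
def laplaceExponent (Λ : Measure ℝ) (u : ℝ) : ℝ := ∫ x, (1 - Real.exp (-u * x)) ∂Λ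

variable {Λ : Measure ℝ}

lemma integrable_one_sub_exp_mul (hΛ : ∀ᵐ x ∂Λ, 0 ≤ x) (hint : Integrable (fun x => x) Λ) {u : ℝ}
    (hu : 0 ≤ u) : Integrable (fun x => 1 - Real.exp (-u * x)) Λ := by
  refine (hint.const_mul u).mono' (by fun_prop) ?_
  filter_upwards [hΛ] with x hx
  rw [neg_mul, Real.norm_of_nonneg (one_sub_exp_neg_nonneg (by positivity))]
  linarith [Real.add_one_le_exp (-(u * x))]

lemma tendsto_laplaceExponent_div (hΛ : ∀ᵐ x ∂Λ, 0 ≤ x) (hint : Integrable (fun x => x) Λ) :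
    Tendsto (fun u => laplaceExponent Λ u / u) (𝓝[>] 0) (𝓝 (∫ x, x ∂Λ)) := by
  simpa [expApprox, integral_div, laplaceExponent]
    using tendsto_integral_expApprox hΛ 1 (by simpa using hint)

lemma tendsto_laplaceExponent (hΛ : ∀ᵐ x ∂Λ, 0 ≤ x) (hint : Integrable (fun x => x) Λ) :
    Tendsto (laplaceExponent Λ) (𝓝[>] 0) (𝓝 0) := by
  have hmul := (tendsto_laplaceExponent_div hΛ hint).mul (tendsto_nhdsWithin_of_tendsto_nhds
    (tendsto_id (α := ℝ) (x := 𝓝 0)))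
  rw [mul_zero] at hmul
  refine hmul.congr' ?_
  filter_upwards [self_mem_nhdsWithin] with u hu using div_mul_cancel₀ _ (ne_of_gt hu)

lemma two_mul_laplaceExponent_sub (hΛ : ∀ᵐ x ∂Λ, 0 ≤ x) (hint : Integrable (fun x => x) Λ) {u : ℝ}
    (hu : 0 ≤ u) :
    2 * laplaceExponent Λ u - laplaceExponent Λ (2 * u) =
      ∫ x, (1 - Real.exp (-u * x)) ^ 2 ∂Λ := by
  rw [laplaceExponent, laplaceExponent, ← integral_const_mul, ← integral_sub
    ((integrable_one_sub_exp_mul hΛ hint hu).const_mul 2)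
    (integrable_one_sub_exp_mul hΛ hint (by positivity))]
  congr with x
  rw [show -(2 * u) * x = -u * x + -u * x by ring, Real.exp_add]
  ring

lemma tendsto_two_mul_laplaceExponent_sub_div (hΛ : ∀ᵐ x ∂Λ, 0 ≤ x)
    (hint : Integrable (fun x => x) Λ) (hsq : Integrable (fun x => x ^ 2) Λ) :
    Tendsto (fun u => (2 * laplaceExponent Λ u - laplaceExponent Λ (2 * u)) / u ^ 2) (𝓝[>] 0)
      (𝓝 (∫ x, x ^ 2 ∂Λ)) := by
  refine (tendsto_integral_expApprox hΛ 2 hsq).congr' ?_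
  filter_upwards [self_mem_nhdsWithin] with u hu
  simp only [two_mul_laplaceExponent_sub hΛ hint (le_of_lt hu), expApprox, div_pow, integral_div]

end LaplaceExponent

namespace HasLevyMeasure

variable {μ Λ : Measure ℝ}

lemma integrable_exp_neg_mul (h : HasLevyMeasure μ Λ) {u : ℝ} (hu : 0 ≤ u) :
    Integrable (fun x => Real.exp (-u * x)) μ := by
  have := h.prob
  refine Integrable.of_bound (by fun_prop) 1 ?_
  filter_upwards [h.nonneg] with x hx
  rw [Real.norm_of_nonneg (Real.exp_pos _).le]
  exact Real.exp_le_one_iff.2 (mul_nonpos_of_nonpos_of_nonneg (by linarith) hx)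

lemma integral_expApprox (h : HasLevyMeasure μ Λ) {u : ℝ} (hu : 0 ≤ u) :
    ∫ x, expApprox u x ∂μ = (1 - Real.exp (-laplaceExponent Λ u)) / u := by
  have := h.prob
  simp only [expApprox, integral_div]
  rw [integral_sub (integrable_const _) (h.integrable_exp_neg_mul hu), h.laplace hu,
    integral_const, probReal_univ, one_smul, laplaceExponent]

/-- With `φ = e^{-ψ}` this is `E (1 - e^{-uX})² = (1 - φ(u))² + (φ(2u) - φ(u)²)`. -/
lemma integral_expApprox_sq (h : HasLevyMeasure μ Λ) {u : ℝ} (hu : 0 ≤ u) :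
    ∫ x, expApprox u x ^ 2 ∂μ = (∫ x, expApprox u x ∂μ) ^ 2 +
      Real.exp (-laplaceExponent Λ u) ^ 2 *
        ((Real.exp (2 * laplaceExponent Λ u - laplaceExponent Λ (2 * u)) - 1) / u ^ 2) := by
  have := h.prob
  have hu2 : 0 ≤ 2 * u := by positivity
  have hexpand (x : ℝ) : (1 - Real.exp (-u * x)) ^ 2 =
      1 - 2 * Real.exp (-u * x) + Real.exp (-(2 * u) * x) := by
    rw [show -(2 * u) * x = -u * x + -u * x by ring, Real.exp_add]
    ring
  have hsq : ∫ x, (1 - Real.exp (-u * x)) ^ 2 ∂μ =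
      1 - 2 * Real.exp (-laplaceExponent Λ u) + Real.exp (-laplaceExponent Λ (2 * u)) := by
    have hexp := (h.integrable_exp_neg_mul hu).const_mul 2
    simp_rw [hexpand]
    rw [integral_add (f := fun x => 1 - 2 * Real.exp (-u * x)) ((integrable_const _).sub hexp)
      (h.integrable_exp_neg_mul hu2), integral_sub (integrable_const _) hexp, integral_const_mul,
      h.laplace hu, h.laplace hu2, integral_const, probReal_univ, one_smul,
      laplaceExponent, laplaceExponent]
  have hprod : Real.exp (-laplaceExponent Λ u) ^ 2 *
      Real.exp (2 * laplaceExponent Λ u - laplaceExponent Λ (2 * u)) =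
        Real.exp (-laplaceExponent Λ (2 * u)) := by
    rw [← Real.exp_nat_mul, ← Real.exp_add]
    congr 1
    push_cast
    ring
  rw [h.integral_expApprox hu, ← mul_div_assoc, mul_sub, hprod]
  simp only [expApprox, div_pow, integral_div, hsq]
  ring

lemma tendsto_integral_expApprox (h : HasLevyMeasure μ Λ) (hint : Integrable (fun x => x) Λ) :
    Tendsto (fun u => ∫ x, expApprox u x ∂μ) (𝓝[>] 0) (𝓝 (∫ x, x ∂Λ)) := by
  have hlim := tendsto_exp_sub_one_div (v := fun u => -u)
    (by simpa using (tendsto_laplaceExponent h.levy.ae_nonneg hint).neg)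
    (by simpa using tendsto_laplaceExponent_div h.levy.ae_nonneg hint)
  refine hlim.congr' ?_
  filter_upwards [self_mem_nhdsWithin] with u hu
  rw [h.integral_expApprox (le_of_lt hu), div_neg, ← neg_div, neg_sub]

lemma tendsto_integral_expApprox_sq (h : HasLevyMeasure μ Λ) (hint : Integrable (fun x => x) Λ)
    (hsq : Integrable (fun x => x ^ 2) Λ) :
    Tendsto (fun u => ∫ x, expApprox u x ^ 2 ∂μ) (𝓝[>] 0)
      (𝓝 ((∫ x, x ∂Λ) ^ 2 + ∫ x, x ^ 2 ∂Λ)) := by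
  have hψ := tendsto_laplaceExponent h.levy.ae_nonneg hint
  have hdiv := tendsto_two_mul_laplaceExponent_sub_div h.levy.ae_nonneg hint hsq
  have hdiff : Tendsto (fun u => 2 * laplaceExponent Λ u - laplaceExponent Λ (2 * u)) (𝓝[>] 0)
      (𝓝 0) := by
    have hmul := hdiv.mul ((tendsto_nhdsWithin_of_tendsto_nhds
      (tendsto_id (α := ℝ) (x := 𝓝 0))).pow 2)
    rw [zero_pow two_ne_zero, mul_zero] at hmul
    refine hmul.congr' ?_
    filter_upwards [self_mem_nhdsWithin] with u hu
    exact div_mul_cancel₀ _ (pow_ne_zero 2 (ne_of_gt hu))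
  have hexp : Tendsto (fun u => Real.exp (-laplaceExponent Λ u) ^ 2) (𝓝[>] 0) (𝓝 1) := by
    simpa using ((Real.continuous_exp.tendsto _).comp hψ.neg).pow 2
  have hlim := ((h.tendsto_integral_expApprox hint).pow 2).add
    (hexp.mul (tendsto_exp_sub_one_div hdiff hdiv))
  rw [one_mul] at hlim
  refine hlim.congr' ?_
  filter_upwards [self_mem_nhdsWithin] with u hu using (h.integral_expApprox_sq (le_of_lt hu)).symm

lemma integrable_sq (h : HasLevyMeasure μ Λ) (hint : Integrable (fun x => x) Λ)
    (hsq : Integrable (fun x => x ^ 2) Λ) : Integrable (fun x => x ^ 2) μ := by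
  have := h.prob
  exact integrable_pow_of_tendsto_expApprox h.nonneg (h.tendsto_integral_expApprox_sq hint hsq)

lemma memLp_two (h : HasLevyMeasure μ Λ) (hint : Integrable (fun x => x) Λ)
    (hsq : Integrable (fun x => x ^ 2) Λ) : MemLp id 2 μ :=
  (memLp_two_iff_integrable_sq aestronglyMeasurable_id).2 (h.integrable_sq hint hsq)

lemma integral_id (h : HasLevyMeasure μ Λ) (hint : Integrable (fun x => x) Λ) :
    ∫ x, x ∂μ = ∫ x, x ∂Λ := by
  have := h.prob
  have hlim := h.tendsto_integral_expApprox hint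
  have hintμ := integrable_pow_of_tendsto_expApprox (k := 1) h.nonneg (by simpa using hlim)
  refine tendsto_nhds_unique ?_ hlim
  simpa using CGMY.tendsto_integral_expApprox h.nonneg 1 hintμ

lemma integral_sq (h : HasLevyMeasure μ Λ) (hint : Integrable (fun x => x) Λ)
    (hsq : Integrable (fun x => x ^ 2) Λ) :
    ∫ x, x ^ 2 ∂μ = (∫ x, x ∂Λ) ^ 2 + ∫ x, x ^ 2 ∂Λ :=
  tendsto_nhds_unique
    (CGMY.tendsto_integral_expApprox h.nonneg 2 (h.integrable_sq hint hsq))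
    (h.tendsto_integral_expApprox_sq hint hsq)

lemma variance_id (h : HasLevyMeasure μ Λ) (hint : Integrable (fun x => x) Λ)
    (hsq : Integrable (fun x => x ^ 2) Λ) : variance id μ = ∫ x, x ^ 2 ∂Λ := by
  have := h.prob
  rw [variance_eq_sub (h.memLp_two hint hsq)]
  simp only [Pi.pow_apply, id]
  rw [h.integral_sq hint hsq, h.integral_id hint, add_sub_cancel_left]

end HasLevyMeasure

end Moments

section NormalLimit

lemma norm_cexp_mul_I_sub_taylor_le (y : ℝ) :
    ‖Complex.exp (y * Complex.I) - 1 - y * Complex.I + (y : ℂ) ^ 2 / 2‖ ≤ 4 * |y| ^ 3 := by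
  have hnorm : ‖(y : ℂ) * Complex.I‖ = |y| := by simp
  rcases le_total |y| 1 with hy | hy
  · have hbound := Complex.norm_exp_sub_sum_le_norm_mul_exp (y * Complex.I) 3
    have htaylor : Complex.exp (y * Complex.I) -
        ∑ m ∈ Finset.range 3, ((y : ℂ) * Complex.I) ^ m / (m.factorial : ℂ) =
        Complex.exp (y * Complex.I) - 1 - y * Complex.I + (y : ℂ) ^ 2 / 2 := by
      simp only [Finset.sum_range_succ, Finset.sum_range_zero, mul_pow, Complex.I_sq]
      norm_num [Nat.factorial]
      ring
    rw [htaylor, hnorm] at hbound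
    have hexp : Real.exp |y| ≤ 4 := by
      linarith [Real.exp_le_exp.2 hy, Real.exp_one_lt_d9]
    nlinarith [pow_nonneg (abs_nonneg y) 3]
  · have hexp : ‖Complex.exp (y * Complex.I)‖ = 1 := Complex.norm_exp_ofReal_mul_I y
    have hsq : ‖(y : ℂ) ^ 2 / 2‖ = |y| ^ 2 / 2 := by simp
    calc ‖Complex.exp (y * Complex.I) - 1 - y * Complex.I + (y : ℂ) ^ 2 / 2‖
        ≤ 1 + 1 + |y| + |y| ^ 2 / 2 := by
          refine (norm_add_le _ _).trans (add_le_add ((norm_sub_le _ _).trans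
            (add_le_add ((norm_sub_le _ _).trans (add_le_add hexp.le (by simp))) hnorm.le)) hsq.le)
      _ ≤ 4 * |y| ^ 3 := by nlinarith [pow_le_pow_left₀ zero_le_one hy 2]

lemma integrable_sq_of_integrable_pow_three {Λ : Measure ℝ} (hΛ : ∀ᵐ x ∂Λ, 0 ≤ x)
    (h1 : Integrable (fun x => x) Λ) (h3 : Integrable (fun x => x ^ 3) Λ) :
    Integrable (fun x => x ^ 2) Λ := by
  refine (h1.add h3).mono' (by fun_prop) ?_
  filter_upwards [hΛ] with x hx
  rw [Real.norm_of_nonneg (sq_nonneg x), Pi.add_apply]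
  nlinarith [mul_nonneg hx (sq_nonneg (x - 1)), sq_nonneg x]

lemma norm_integral_cexp_sub_taylor_le {Λ : Measure ℝ} (hΛ : ∀ᵐ x ∂Λ, 0 ≤ x)
    (h1 : Integrable (fun x => x) Λ) (h3 : Integrable (fun x => x ^ 3) Λ)
    {s : ℝ} (hexp : Integrable (fun x : ℝ => Complex.exp (s * x * Complex.I) - 1) Λ) :
    ‖(∫ x : ℝ, (Complex.exp (s * x * Complex.I) - 1) ∂Λ) - (s * ∫ x, x ∂Λ : ℝ) * Complex.I +
      (s ^ 2 / 2 * ∫ x, x ^ 2 ∂Λ : ℝ)‖ ≤ 4 * |s| ^ 3 * ∫ x, x ^ 3 ∂Λ := by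
  have h2 := integrable_sq_of_integrable_pow_three hΛ h1 h3
  have hlin : Integrable (fun x : ℝ => ((s * x : ℝ) : ℂ) * Complex.I) Λ :=
    (h1.const_mul s).ofReal.mul_const _
  have hquad : Integrable (fun x : ℝ => ((s ^ 2 / 2 * x ^ 2 : ℝ) : ℂ)) Λ :=
    (h2.const_mul (s ^ 2 / 2)).ofReal
  rw [← integral_const_mul, ← integral_const_mul, ← integral_complex_ofReal,
    ← integral_complex_ofReal, ← integral_mul_const, ← integral_sub hexp hlin,
    ← integral_add (f := fun x : ℝ => Complex.exp (s * x * Complex.I) - 1 -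
      ((s * x : ℝ) : ℂ) * Complex.I) (hexp.sub hlin) hquad, ← integral_const_mul]
  refine norm_integral_le_of_norm_le (h3.const_mul (4 * |s| ^ 3)) ?_
  filter_upwards [hΛ] with x hx
  convert norm_cexp_mul_I_sub_taylor_le (s * x) using 1
  · push_cast
    ring_nf
  · rw [abs_mul, abs_of_nonneg hx]
    ring

variable {μ Λ : Measure ℝ}

lemma charFun_map_standardize (μ : Measure ℝ) (m σ s : ℝ) :
    charFun (μ.map fun x => (x - m) / σ) s =
      Complex.exp (-(s / σ * m : ℝ) * Complex.I) * charFun μ (s / σ) := by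
  rw [charFun_apply_real, charFun_apply_real, integral_map (by fun_prop) (by fun_prop),
    ← integral_const_mul]
  congr with x
  rw [← Complex.exp_add]
  congr 1
  push_cast
  ring

lemma HasLevyMeasure.exists_charFun_standardize_eq (h : HasLevyMeasure μ Λ)
    (h1 : Integrable (fun x => x) Λ) (h3 : Integrable (fun x => x ^ 3) Λ)
    (hpos : 0 < ∫ x, x ^ 2 ∂Λ) (s : ℝ) :
    ∃ r : ℂ, ‖r‖ ≤ 4 * |s| ^ 3 * ((∫ x, x ^ 3 ∂Λ) / √(∫ x, x ^ 2 ∂Λ) ^ 3) ∧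
      charFun (μ.map fun x => (x - ∫ y, y ∂Λ) / √(∫ y, y ^ 2 ∂Λ)) s =
        Complex.exp (-(s ^ 2 / 2) + r) := by
  set σ := √(∫ x, x ^ 2 ∂Λ)
  have hσ : 0 < σ := Real.sqrt_pos.2 hpos
  have hexp : Integrable (fun x : ℝ => Complex.exp ((s / σ : ℝ) * x * Complex.I) - 1) Λ := by
    simpa only [mul_right_comm _ Complex.I] using
      h.levy.integrable_cexp_sub_one (z := (s / σ : ℝ) * Complex.I) (by simp)
  have hvar : (s / σ) ^ 2 / 2 * ∫ x, x ^ 2 ∂Λ = s ^ 2 / 2 := by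
    rw [div_pow, Real.sq_sqrt hpos.le]
    field_simp
  have htaylor := norm_integral_cexp_sub_taylor_le h.levy.ae_nonneg h1 h3 hexp
  refine ⟨_, htaylor.trans_eq ?_, ?_⟩
  · rw [abs_div, abs_of_pos hσ]
    ring
  · rw [charFun_map_standardize, h.charFun_eq, ← Complex.exp_add, hvar]
    congr 1
    push_cast
    ring

lemma HasLevyMeasure.tendsto_charFun_standardize {ι : Type*} {l : Filter ι} {μ Λ : ι → Measure ℝ}
    (h : ∀ᶠ i in l, HasLevyMeasure (μ i) (Λ i))
    (h1 : ∀ᶠ i in l, Integrable (fun x => x) (Λ i))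
    (h3 : ∀ᶠ i in l, Integrable (fun x => x ^ 3) (Λ i))
    (hpos : ∀ᶠ i in l, 0 < ∫ x, x ^ 2 ∂Λ i)
    (hlim : Tendsto (fun i => (∫ x, x ^ 3 ∂Λ i) / √(∫ x, x ^ 2 ∂Λ i) ^ 3) l (𝓝 0)) (s : ℝ) :
    Tendsto (fun i => charFun ((μ i).map fun x => (x - ∫ y, y ∂Λ i) / √(∫ y, y ^ 2 ∂Λ i)) s) l
      (𝓝 (Complex.exp (-(s ^ 2 / 2)))) := by
  obtain rfl | _ := l.eq_or_neBot
  · exact tendsto_bot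
  have hexists : ∀ᶠ i in l, ∃ r : ℂ,
      ‖r‖ ≤ 4 * |s| ^ 3 * ((∫ x, x ^ 3 ∂Λ i) / √(∫ x, x ^ 2 ∂Λ i) ^ 3) ∧
      charFun ((μ i).map fun x => (x - ∫ y, y ∂Λ i) / √(∫ y, y ^ 2 ∂Λ i)) s =
        Complex.exp (-(s ^ 2 / 2) + r) := by
    filter_upwards [h, h1, h3, hpos] with i hi h1 h3 hpos
      using hi.exists_charFun_standardize_eq h1 h3 hpos s
  obtain ⟨r, hr⟩ := hexists.choice
  have hr0 : Tendsto r l (𝓝 0) :=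
    squeeze_zero_norm' (hr.mono fun i hi => hi.1) (by simpa using hlim.const_mul (4 * |s| ^ 3))
  have hexp := (Complex.continuous_exp.tendsto _).comp (hr0.const_add (-((s : ℂ) ^ 2 / 2)))
  rw [add_zero] at hexp
  exact hexp.congr' (hr.mono fun i hi => hi.2.symm)

section RandomVariables

variable {Ω : Type*} [MeasurableSpace Ω] {P : Measure Ω}

lemma HasLevyMeasure.memLp_two_of_map {X : Ω → ℝ} (hX : Measurable X)
    (h : HasLevyMeasure (P.map X) Λ) (h1 : Integrable (fun x => x) Λ)
    (h2 : Integrable (fun x => x ^ 2) Λ) : MemLp X 2 P :=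
  (h.memLp_two h1 h2).comp_of_map hX.aemeasurable

lemma HasLevyMeasure.integral_eq {X : Ω → ℝ} (hX : Measurable X)
    (h : HasLevyMeasure (P.map X) Λ) (h1 : Integrable (fun x => x) Λ) :
    ∫ ω, X ω ∂P = ∫ x, x ∂Λ := by
  rw [← h.integral_id h1, integral_map hX.aemeasurable (by fun_prop)]

lemma HasLevyMeasure.integral_sq_eq {X : Ω → ℝ} (hX : Measurable X)
    (h : HasLevyMeasure (P.map X) Λ) (h1 : Integrable (fun x => x) Λ)
    (h2 : Integrable (fun x => x ^ 2) Λ) :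
    ∫ ω, X ω ^ 2 ∂P = (∫ x, x ∂Λ) ^ 2 + ∫ x, x ^ 2 ∂Λ := by
  rw [← h.integral_sq h1 h2, integral_map hX.aemeasurable (by fun_prop)]

lemma HasLevyMeasure.variance_eq {X : Ω → ℝ} (hX : Measurable X)
    (h : HasLevyMeasure (P.map X) Λ) (h1 : Integrable (fun x => x) Λ)
    (h2 : Integrable (fun x => x ^ 2) Λ) : variance X P = ∫ x, x ^ 2 ∂Λ := by
  rw [← h.variance_id h1 h2, variance_id_map hX.aemeasurable]

/-- A central limit theorem of Lyapunov type: the third moments of the Lévy measures play the role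
of the third absolute moments of the summands. -/
theorem tendstoInDistribution_gaussianReal_of_hasLevyMeasure [IsProbabilityMeasure P] {ι : Type*}
    {l : Filter ι} [l.IsCountablyGenerated] {X : ι → Ω → ℝ} {Λ : ι → Measure ℝ}
    (hX : ∀ i, Measurable (X i))
    (h : ∀ᶠ i in l, HasLevyMeasure (P.map (X i)) (Λ i))
    (h1 : ∀ᶠ i in l, Integrable (fun x => x) (Λ i))
    (h3 : ∀ᶠ i in l, Integrable (fun x => x ^ 3) (Λ i))
    (hpos : ∀ᶠ i in l, 0 < ∫ x, x ^ 2 ∂Λ i)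
    (hlim : Tendsto (fun i => (∫ x, x ^ 3 ∂Λ i) / √(∫ x, x ^ 2 ∂Λ i) ^ 3) l (𝓝 0)) :
    TendstoInDistribution (fun i ω => (X i ω - ∫ ω', X i ω' ∂P) / √(variance (X i) P))
      l (id : ℝ → ℝ) (fun _ => P) (gaussianReal 0 1) where
  forall_aemeasurable i := by have := hX i; fun_prop
  tendsto := by
    refine tendsto_of_seq_tendsto fun u hu =>
      ProbabilityMeasure.tendsto_iff_tendsto_charFun.2 fun s => ?_
    have hgauss : charFun ((gaussianReal 0 1).map id) s = Complex.exp (-(s ^ 2 / 2)) := by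
      rw [Measure.map_id, charFun_gaussianReal]
      simp
    simp only [ProbabilityMeasure.coe_mk, hgauss]
    refine ((HasLevyMeasure.tendsto_charFun_standardize h h1 h3 hpos hlim s).comp hu).congr' ?_
    filter_upwards [hu.eventually h, hu.eventually h1, hu.eventually h3] with n h h1 h3
    have h2 := integrable_sq_of_integrable_pow_three h.levy.ae_nonneg h1 h3
    simp only [Function.comp_apply, ← h.integral_eq (hX _) h1, ← h.variance_eq (hX _) h1 h2]
    rw [Measure.map_map (by fun_prop) (hX _)]
    rfl

end RandomVariables

end NormalLimit

section Coupling

lemma continuous_cdf {μ : Measure ℝ} [IsProbabilityMeasure μ] (h : ∀ x, μ {x} = 0) :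
    Continuous (cdf μ) := by
  refine continuous_iff_continuousAt.2 fun x => ?_
  rw [(monotone_cdf μ).continuousAt_iff_leftLim_eq_rightLim, (cdf μ).rightLim_eq]
  have hjump := (cdf μ).measure_singleton x
  rw [measure_cdf, h x, eq_comm, ENNReal.ofReal_eq_zero] at hjump
  exact le_antisymm ((monotone_cdf μ).leftLim_le le_rfl) (by linarith)

lemma exists_cdf_eq {μ : Measure ℝ} [IsProbabilityMeasure μ] (h : ∀ x, μ {x} = 0) {u : ℝ}
    (hu : u ∈ Ioo 0 1) : ∃ x, cdf μ x = u :=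
  mem_range_of_exists_le_of_exists_ge (continuous_cdf h)
    ((tendsto_cdf_atBot μ).eventually_le_const hu.1).exists
    ((tendsto_cdf_atTop μ).eventually_const_le hu.2).exists

lemma measure_cdf_le {μ : Measure ℝ} [IsProbabilityMeasure μ] (h : ∀ x, μ {x} = 0) {u : ℝ}
    (hu : u ∈ Icc 0 1) : μ {x | cdf μ x ≤ u} = ENNReal.ofReal u := by
  rcases hu.2.eq_or_lt with rfl | hu1
  · simp [cdf_le_one]
  refine le_antisymm ?_ ?_
  · have hlim : Tendsto ENNReal.ofReal (𝓝[>] u) (𝓝 (ENNReal.ofReal u)) :=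
      (ENNReal.continuous_ofReal.tendsto _).mono_left nhdsWithin_le_nhds
    refine ge_of_tendsto hlim ?_
    filter_upwards [Ioo_mem_nhdsGT hu1] with v hv
    obtain ⟨x, rfl⟩ := exists_cdf_eq h ⟨hu.1.trans_lt hv.1, hv.2⟩
    rw [ofReal_cdf]
    exact measure_mono fun y hy => ((monotone_cdf μ).reflect_lt (lt_of_le_of_lt hy hv.1)).le
  · rcases hu.1.eq_or_lt with rfl | hu0
    · simp
    obtain ⟨x, rfl⟩ := exists_cdf_eq h ⟨hu0, hu1⟩
    rw [ofReal_cdf]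
    exact measure_mono fun y hy => monotone_cdf μ hy

lemma exists_map_eq_volume_unitInterval (μ : Measure ℝ) [IsProbabilityMeasure μ]
    (h : ∀ x, μ {x} = 0) : ∃ g : ℝ → unitInterval, Measurable g ∧ μ.map g = volume := by
  let g : ℝ → unitInterval := fun x => ⟨cdf μ x, cdf_nonneg μ x, cdf_le_one μ x⟩
  have hg : Measurable g := ((continuous_cdf h).subtype_mk _).measurable
  have : IsProbabilityMeasure (μ.map g) := Measure.isProbabilityMeasure_map hg.aemeasurable
  refine ⟨g, hg, Measure.ext_of_Iic _ _ fun u => ?_⟩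
  rw [Measure.map_apply hg measurableSet_Iic, unitInterval.volume_Iic]
  exact measure_cdf_le h u.2

variable {Ω : Type*} [MeasurableSpace Ω] {P : Measure Ω} [IsProbabilityMeasure P]

lemma exists_map_prodMk_eq_compProd {α β : Type*} [MeasurableSpace α] [MeasurableSpace β]
    [StandardBorelSpace β] [Nonempty β] {X : Ω → α} {V : Ω → unitInterval} (hX : Measurable X)
    (hV : Measurable V) (hXV : IndepFun X V P) (hunif : P.map V = volume) (κ : Kernel α β)
    [IsMarkovKernel κ] :
    ∃ Z : Ω → β, Measurable Z ∧ P.map (fun ω => (X ω, Z ω)) = P.map X ⊗ₘ κ := by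
  obtain ⟨f, hf, hfκ⟩ := κ.exists_measurable_map_eq_unitInterval
  have hprod : P.map (fun ω => (X ω, V ω)) = (P.map X).prod volume := by
    rw [← hunif]
    exact (indepFun_iff_map_prod_eq_prod_map_map hX.aemeasurable hV.aemeasurable).1 hXV
  have hq : Measurable fun q : α × unitInterval => (q.1, f q.1 q.2) := measurable_fst.prodMk hf
  have hmap : P.map (fun ω => (X ω, f (X ω) (V ω))) =
      ((P.map X).prod volume).map fun q : α × unitInterval => (q.1, f q.1 q.2) := by
    rw [← hprod, Measure.map_map hq (hX.prodMk hV)]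
    rfl
  refine ⟨fun ω => f (X ω) (V ω), hf.comp (hX.prodMk hV), ?_⟩
  rw [hmap]
  ext s hs
  rw [Measure.map_apply hq hs, Measure.prod_apply (hq hs), Measure.compProd_apply hs]
  refine lintegral_congr fun x => ?_
  have hfx : Measurable (f x) := hf.comp measurable_prodMk_left
  rw [← hfκ x, Measure.map_apply hfx (measurable_prodMk_left hs)]
  rfl

lemma exists_map_prodMk_eq {α β : Type*} [MeasurableSpace α] [MeasurableSpace β]
    [StandardBorelSpace β] [Nonempty β] {X : Ω → α} {W : Ω → ℝ} (hX : Measurable X)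
    (hW : Measurable W) (hXW : IndepFun X W P) (hatom : ∀ c, P.map W {c} = 0)
    {π : Measure (α × β)} [IsFiniteMeasure π] (hπ : π.fst = P.map X) :
    ∃ Z : Ω → β, Measurable Z ∧ P.map (fun ω => (X ω, Z ω)) = π := by
  have := Measure.isProbabilityMeasure_map hW.aemeasurable (μ := P)
  obtain ⟨g, hg, hunif⟩ := exists_map_eq_volume_unitInterval (P.map W) hatom
  rw [Measure.map_map hg hW] at hunif
  obtain ⟨Z, hZ, hmap⟩ := exists_map_prodMk_eq_compProd hX (hg.comp hW)
    (hXW.comp measurable_id hg) hunif π.condKernel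
  exact ⟨Z, hZ, by rw [hmap, ← hπ, π.disintegrate]⟩

lemma exists_indepFun_add_of_map_eq_conv {X W : Ω → ℝ} (hX : Measurable X) (hW : Measurable W)
    (hXW : IndepFun X W P) (hatom : ∀ c, P.map W {c} = 0) {μ₁ μ₂ : Measure ℝ}
    [IsProbabilityMeasure μ₁] [IsProbabilityMeasure μ₂] (hlaw : P.map X = μ₁ ∗ μ₂) :
    ∃ A : Ω → ℝ, Measurable A ∧ IndepFun A (X - A) P ∧
      P.map A = μ₁ ∧ P.map (X - A) = μ₂ := by
  have hadd : Measurable fun p : ℝ × ℝ => (p.1 + p.2, p.1) := by fun_prop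
  have hsub : Measurable fun q : ℝ × ℝ => (q.2, q.1 - q.2) := by fun_prop
  have hfst : ((μ₁.prod μ₂).map fun p => (p.1 + p.2, p.1)).fst = P.map X := by
    rw [hlaw, Measure.fst_map_prodMk measurable_fst, Measure.conv]
  obtain ⟨A, hA, hmap⟩ := exists_map_prodMk_eq hX hW hXW hatom hfst
  have hjoint : P.map (fun ω => (A ω, (X - A) ω)) = μ₁.prod μ₂ := by
    have hcomp := congrArg (Measure.map fun q : ℝ × ℝ => (q.2, q.1 - q.2)) hmap
    rw [Measure.map_map hsub (hX.prodMk hA), Measure.map_map hsub hadd] at hcomp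
    simpa [Function.comp_def] using hcomp
  have hXA : Measurable (X - A) := hX.sub hA
  have hA₁ : P.map A = μ₁ := by
    rw [← Measure.fst_map_prodMk hXA, hjoint, Measure.fst_prod]
  have hA₂ : P.map (X - A) = μ₂ := by
    rw [← Measure.snd_map_prodMk hA, hjoint, Measure.snd_prod]
  refine ⟨A, hA, ?_, hA₁, hA₂⟩
  rw [indepFun_iff_map_prod_eq_prod_map_map hA.aemeasurable hXA.aemeasurable, hjoint, hA₁, hA₂]

/-- The randomness needed to split `X` comes from the independent variable `W`. -/
theorem exists_indepFun_add_of_hasLevyMeasure {X W : Ω → ℝ} (hX : Measurable X)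
    (hW : Measurable W) (hXW : IndepFun X W P) (hatom : ∀ c, P.map W {c} = 0)
    {Λ₁ Λ₂ : Measure ℝ} [SFinite Λ₁] [SFinite Λ₂] (h : HasLevyMeasure (P.map X) (Λ₁ + Λ₂)) :
    ∃ A : Ω → ℝ, Measurable A ∧ IndepFun A (X - A) P ∧ HasLevyMeasure (P.map A) Λ₁ ∧
      HasLevyMeasure (P.map (X - A)) Λ₂ := by
  obtain ⟨μ₁, h₁⟩ := exists_hasLevyMeasure (h.levy.mono (Measure.le_add_right le_rfl))
  obtain ⟨μ₂, h₂⟩ := exists_hasLevyMeasure (h.levy.mono (Measure.le_add_left le_rfl))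
  have := h₁.prob
  have := h₂.prob
  obtain ⟨A, hA, hindep, rfl, rfl⟩ :=
    exists_indepFun_add_of_map_eq_conv hX hW hXW hatom (h.unique (h₁.conv h₂))
  exact ⟨A, hA, hindep, h₁, h₂⟩

end Coupling

section ThorinMeasure

lemma inv_mul_exp_mul_one_sub_exp (a u x : ℝ) :
    x⁻¹ * Real.exp (-(a * x)) * (1 - Real.exp (-u * x)) =
      x⁻¹ • (Real.exp (-(a * x)) - Real.exp (-((a + u) * x))) := by
  rw [smul_eq_mul, show -((a + u) * x) = -(a * x) + -u * x by ring, Real.exp_add]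
  ring

lemma inv_mul_exp_mul_one_sub_exp_nonneg {a u x : ℝ} (hu : 0 ≤ u) (hx : 0 < x) :
    0 ≤ x⁻¹ * Real.exp (-(a * x)) * (1 - Real.exp (-u * x)) := by
  have := one_sub_exp_neg_nonneg (mul_nonneg hu hx.le)
  rw [neg_mul]
  positivity

lemma integrableOn_inv_mul_exp_mul_one_sub_exp {a u : ℝ} (ha : 0 < a) (hu : 0 ≤ u) :
    IntegrableOn (fun x => x⁻¹ * Real.exp (-(a * x)) * (1 - Real.exp (-u * x))) (Ioi 0) := by
  refine ((integrableOn_exp_mul_Ioi (neg_lt_zero.2 ha) 0).const_mul u).mono' (by fun_prop) ?_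
  filter_upwards [ae_restrict_mem measurableSet_Ioi] with x (hx : 0 < x)
  rw [Real.norm_of_nonneg (inv_mul_exp_mul_one_sub_exp_nonneg hu hx)]
  calc x⁻¹ * Real.exp (-(a * x)) * (1 - Real.exp (-u * x))
      ≤ x⁻¹ * Real.exp (-(a * x)) * (u * x) := by
        gcongr
        linarith [Real.add_one_le_exp (-u * x)]
    _ = u * Real.exp (-a * x) := by
        rw [neg_mul]
        field_simp

lemma lintegral_inv_mul_exp_mul_one_sub_exp {a u : ℝ} (ha : 0 < a) (hu : 0 ≤ u) :
    ∫⁻ x in Ioi 0, ENNReal.ofReal (x⁻¹ * Real.exp (-(a * x))) *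
      ENNReal.ofReal (1 - Real.exp (-u * x)) = ENNReal.ofReal (Real.log (1 + u / a)) := by
  have hint := integrableOn_inv_mul_exp_mul_one_sub_exp ha hu
  have hcont : Continuous fun x : ℝ => Real.exp (-x) := by fun_prop
  have hzero : Tendsto (fun x : ℝ => Real.exp (-x)) (𝓝[>] 0) (𝓝 1) := by
    simpa using (hcont.tendsto 0).mono_left nhdsWithin_le_nhds
  have hfrullani : ∫ x in Ioi 0, x⁻¹ * Real.exp (-(a * x)) * (1 - Real.exp (-u * x)) =
      Real.log (1 + u / a) := by
    simp only [inv_mul_exp_mul_one_sub_exp] at hint ⊢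
    rw [Frullani.integral_Ioi_eq (f := fun x : ℝ => Real.exp (-x))
      (hcont.locallyIntegrable.locallyIntegrableOn _) ha (add_pos_of_pos_of_nonneg ha hu) hzero
      Real.tendsto_exp_neg_atTop_nhds_zero hint, sub_zero, smul_eq_mul, mul_one, add_div,
      div_self ha.ne']
  rw [← hfrullani, ofReal_integral_eq_lintegral_ofReal hint]
  · refine setLIntegral_congr_fun measurableSet_Ioi fun x (hx : 0 < x) => ?_
    rw [← ENNReal.ofReal_mul (by positivity)]
  · filter_upwards [ae_restrict_mem measurableSet_Ioi] with x hx
      using inv_mul_exp_mul_one_sub_exp_nonneg hu hx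

lemma lintegral_inv_mul_exp_mul_pow {a : ℝ} (ha : 0 < a) (k : ℕ) :
    ∫⁻ x in Ioi 0, ENNReal.ofReal (x⁻¹ * Real.exp (-(a * x))) * ENNReal.ofReal (x ^ (k + 1)) =
      ENNReal.ofReal (k.factorial / a ^ (k + 1)) := by
  have hgamma : ∫ x in Ioi 0, x ^ ((k + 1 : ℝ) - 1) * Real.exp (-(a * x)) =
      k.factorial / a ^ (k + 1) := by
    rw [Real.integral_rpow_mul_exp_neg_mul_Ioi (by positivity) ha, Real.Gamma_nat_eq_factorial,
      ← Nat.cast_succ, Real.rpow_natCast, one_div, inv_pow, mul_comm, div_eq_mul_inv]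
  rw [← hgamma, ofReal_integral_eq_lintegral_ofReal]
  · refine setLIntegral_congr_fun measurableSet_Ioi fun x (hx : 0 < x) => ?_
    rw [← ENNReal.ofReal_mul (by positivity), add_sub_cancel_right, Real.rpow_natCast]
    congr 1
    field_simp
    ring
  · exact Integrable.of_integral_ne_zero (by rw [hgamma]; positivity)
  · filter_upwards [ae_restrict_mem measurableSet_Ioi] with x (hx : 0 < x)
    positivity

lemma ae_zero_le_log_one_add_div {U : Measure ℝ} (hU : ∀ᵐ a ∂U, 0 < a) {u : ℝ} (hu : 0 ≤ u) :
    0 ≤ᵐ[U] fun a => Real.log (1 + u / a) :=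
  hU.mono fun _ ha => Real.log_nonneg (le_add_of_nonneg_right (div_nonneg hu ha.le))

/-- The Lévy measure `x⁻¹ (∫ e^{-ax} U(da)) dx` of the generalized gamma convolution with Thorin
measure `U`. -/
def thorinLevy (U : Measure ℝ) : Measure ℝ :=
  (volume.restrict (Ioi 0)).withDensity fun x =>
    ∫⁻ a, ENNReal.ofReal (x⁻¹ * Real.exp (-(a * x))) ∂U

instance sFinite_thorinLevy (U : Measure ℝ) : SFinite (thorinLevy U) := by
  unfold thorinLevy; infer_instance

lemma thorinLevy_absolutelyContinuous (U : Measure ℝ) : thorinLevy U ≪ volume.restrict (Ioi 0) :=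
  withDensity_absolutelyContinuous _ _

lemma ae_nonneg_thorinLevy (U : Measure ℝ) : ∀ᵐ x ∂thorinLevy U, 0 ≤ x :=
  (thorinLevy_absolutelyContinuous U).ae_le
    ((ae_restrict_mem measurableSet_Ioi).mono fun _ hx => le_of_lt hx)

variable {U : Measure ℝ} [SFinite U]

lemma measurable_thorinDensity :
    Measurable fun x => ∫⁻ a, ENNReal.ofReal (x⁻¹ * Real.exp (-(a * x))) ∂U :=
  Measurable.lintegral_prod_right' (f := fun p : ℝ × ℝ =>
    ENNReal.ofReal (p.1⁻¹ * Real.exp (-(p.2 * p.1)))) (by fun_prop)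

lemma thorinLevy_add (U₁ U₂ : Measure ℝ) [SFinite U₁] :
    thorinLevy (U₁ + U₂) = thorinLevy U₁ + thorinLevy U₂ := by
  unfold thorinLevy
  rw [← withDensity_add_left measurable_thorinDensity]
  congr 1 with x
  rw [lintegral_add_measure, Pi.add_apply]

lemma lintegral_thorinLevy {f : ℝ → ℝ≥0∞} (hf : Measurable f) :
    ∫⁻ x, f x ∂thorinLevy U =
      ∫⁻ a, (∫⁻ x in Ioi 0, ENNReal.ofReal (x⁻¹ * Real.exp (-(a * x))) * f x) ∂U := by
  rw [thorinLevy, lintegral_withDensity_eq_lintegral_mul _ measurable_thorinDensity hf,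
    lintegral_lintegral_swap (f := fun a x => ENNReal.ofReal (x⁻¹ * Real.exp (-(a * x))) * f x)
      (by fun_prop)]
  refine lintegral_congr fun x => ?_
  rw [Pi.mul_apply, lintegral_mul_const _ (by fun_prop)]

lemma lintegral_one_sub_exp_thorinLevy (hU : ∀ᵐ a ∂U, 0 < a) {u : ℝ} (hu : 0 ≤ u) :
    ∫⁻ x, ENNReal.ofReal (1 - Real.exp (-u * x)) ∂thorinLevy U =
      ∫⁻ a, ENNReal.ofReal (Real.log (1 + u / a)) ∂U := by
  rw [lintegral_thorinLevy (by fun_prop)]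
  exact lintegral_congr_ae (hU.mono fun a ha => lintegral_inv_mul_exp_mul_one_sub_exp ha hu)

lemma integral_one_sub_exp_thorinLevy (hU : ∀ᵐ a ∂U, 0 < a) {u : ℝ} (hu : 0 ≤ u) :
    ∫ x, (1 - Real.exp (-u * x)) ∂thorinLevy U = ∫ a, Real.log (1 + u / a) ∂U := by
  have hlog : Measurable fun a : ℝ => Real.log (1 + u / a) := by fun_prop
  rw [integral_eq_lintegral_of_nonneg_ae _ (by fun_prop), integral_eq_lintegral_of_nonneg_ae
    (ae_zero_le_log_one_add_div hU hu) hlog.aestronglyMeasurable,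
    lintegral_one_sub_exp_thorinLevy hU hu]
  filter_upwards [ae_nonneg_thorinLevy U] with x hx
  rw [neg_mul]
  exact one_sub_exp_neg_nonneg (mul_nonneg hu hx)

lemma integrable_log_one_add_div (hU : ∀ᵐ a ∂U, 0 < a)
    (hlevy : IsSubordinatorLevyMeasure (thorinLevy U)) {u : ℝ} (hu : 0 ≤ u) :
    Integrable (fun a => Real.log (1 + u / a)) U := by
  have hlog : Measurable fun a : ℝ => Real.log (1 + u / a) := by fun_prop
  have hexp : Integrable (fun x => 1 - Real.exp (-u * x)) (thorinLevy U) := by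
    have := (hlevy.integrable_cexp_sub_one (z := (-u : ℝ)) (by simpa using hu)).re.neg
    refine this.congr (ae_of_all _ fun x => ?_)
    simp [Complex.exp_re]
  refine ⟨hlog.aestronglyMeasurable,
    (hasFiniteIntegral_iff_ofReal (ae_zero_le_log_one_add_div hU hu)).2 ?_⟩
  rw [← lintegral_one_sub_exp_thorinLevy hU hu]
  exact hexp.lintegral_lt_top

lemma lintegral_pow_thorinLevy (hU : ∀ᵐ a ∂U, 0 < a) (k : ℕ) :
    ∫⁻ x, ENNReal.ofReal (x ^ (k + 1)) ∂thorinLevy U =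
      ENNReal.ofReal k.factorial * ∫⁻ a, ENNReal.ofReal (1 / a ^ (k + 1)) ∂U := by
  rw [lintegral_thorinLevy (by fun_prop), ← lintegral_const_mul _ (by fun_prop)]
  refine lintegral_congr_ae (hU.mono fun a ha => ?_)
  beta_reduce
  rw [lintegral_inv_mul_exp_mul_pow ha, ← ENNReal.ofReal_mul (by positivity), mul_one_div]

lemma thorinLevy_univ_eq_top (hU : ∀ᵐ a ∂U, 0 < a) (hU0 : U ≠ 0) : thorinLevy U univ = ∞ := by
  have hinner : ∀ᵐ a ∂U,
      ∫⁻ x in Ioi 0, ENNReal.ofReal (x⁻¹ * Real.exp (-(a * x))) * 1 = ∞ := by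
    filter_upwards [hU] with a ha
    have hlim : Tendsto (fun u : ℝ => ENNReal.ofReal (Real.log (1 + u / a))) atTop (𝓝 ∞) :=
      ENNReal.tendsto_ofReal_atTop.comp (Real.tendsto_log_atTop.comp
        (tendsto_atTop_add_const_left _ _ (tendsto_id.atTop_div_const ha)))
    refine top_unique (le_of_tendsto hlim ?_)
    filter_upwards [eventually_ge_atTop 0] with u hu
    rw [← lintegral_inv_mul_exp_mul_one_sub_exp ha hu]
    gcongr with x
    exact ENNReal.ofReal_le_one.2 (by linarith [Real.exp_pos (-u * x)])
  rw [← lintegral_one, lintegral_thorinLevy measurable_const, lintegral_congr_ae hinner,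
    lintegral_const, ENNReal.top_mul (by simpa using hU0)]

lemma measure_lt_top_of_integrable_log {U : Measure ℝ}
    (hlog : Integrable (fun a => Real.log (1 + 1 / a)) U) {K : Set ℝ} (hK : IsCompact K)
    (hK0 : K ⊆ Ioi 0) : U K < ∞ := by
  rcases K.eq_empty_or_nonempty with rfl | hne
  · simp
  obtain ⟨b, hbK, hb⟩ := hK.exists_isGreatest hne
  have hb0 : 0 < b := hK0 hbK
  have hlogb : 0 < Real.log (1 + 1 / b) :=
    Real.log_pos (lt_add_of_pos_right 1 (one_div_pos.2 hb0))
  refine (measure_mono fun a ha => ?_).trans_lt (hlog.measure_norm_ge_lt_top hlogb)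
  have ha0 : 0 < a := hK0 ha
  refine (Real.log_le_log (by positivity) ?_).trans (Real.le_norm_self _)
  gcongr
  exact hb ha

lemma abs_log_le_log_one_add_one_div {a : ℝ} (ha : a ∈ Ioc 0 1) :
    |Real.log a| ≤ Real.log (1 + 1 / a) := by
  rw [abs_of_nonpos (Real.log_nonpos ha.1.le ha.2), ← Real.log_inv]
  exact Real.log_le_log (inv_pos.2 ha.1) (by rw [one_div]; linarith)

lemma inv_le_two_mul_log_one_add_one_div {a : ℝ} (ha : 1 < a) :
    a⁻¹ ≤ 2 * Real.log (1 + 1 / a) := by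
  calc a⁻¹ ≤ 2 * (1 - (1 + 1 / a)⁻¹) := by
        rw [show 1 - (1 + 1 / a)⁻¹ = 1 / (a + 1) by field_simp; ring, ← one_div, mul_one_div,
          div_le_div_iff₀ (by linarith) (by linarith)]
        linarith
    _ ≤ 2 * Real.log (1 + 1 / a) := by
        gcongr
        exact Real.one_sub_inv_le_log_of_pos (by positivity)

lemma isThorinMeasure_of_integrable_log {U : Measure ℝ} (hU : ∀ᵐ a ∂U, 0 < a)
    (hlog : Integrable (fun a => Real.log (1 + 1 / a)) U) : IsThorinMeasure U where
  support := by simpa [ae_iff, Iic] using hU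
  radon _ := measure_lt_top_of_integrable_log hlog
  near_zero := by
    refine (setLIntegral_mono' measurableSet_Ioc fun a ha => ENNReal.ofReal_le_ofReal
      (abs_log_le_log_one_add_one_div ha)).trans_lt hlog.integrableOn.lintegral_lt_top
  at_top := by
    refine (setLIntegral_mono' measurableSet_Ioi fun a ha => ENNReal.ofReal_le_ofReal
      (inv_le_two_mul_log_one_add_one_div ha)).trans_lt
        (hlog.const_mul 2).integrableOn.lintegral_lt_top

theorem HasLevyMeasure.isGenGammaConvolution {μ : Measure ℝ} (hU : ∀ᵐ a ∂U, 0 < a)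
    (h : HasLevyMeasure μ (thorinLevy U)) : IsGenGammaConvolution μ :=
  ⟨h.prob, by simpa [ae_iff, Iio] using h.nonneg, U, isThorinMeasure_of_integrable_log hU
    (integrable_log_one_add_div hU h.levy zero_le_one), fun u hu => by
      rw [h.laplace hu, integral_one_sub_exp_thorinLevy hU hu]⟩

end ThorinMeasure

section MixedPower

/-- The measure `c z ^ (α - 1) dz` on `S`. -/
def powerMeasure (c α : ℝ) (S : Set ℝ) : Measure ℝ :=
  (volume.restrict S).withDensity fun z => ENNReal.ofReal (c * z ^ (α - 1))

instance sFinite_powerMeasure (c α : ℝ) (S : Set ℝ) : SFinite (powerMeasure c α S) := by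
  unfold powerMeasure; infer_instance

lemma ae_mem_powerMeasure (c α : ℝ) {S : Set ℝ} (hS : MeasurableSet S) :
    ∀ᵐ z ∂powerMeasure c α S, z ∈ S :=
  (withDensity_absolutelyContinuous _ _).ae_le (ae_restrict_mem hS)

lemma powerMeasure_union (c α : ℝ) {S S' : Set ℝ} (hd : Disjoint S S') (hS' : MeasurableSet S') :
    powerMeasure c α (S ∪ S') = powerMeasure c α S + powerMeasure c α S' := by
  unfold powerMeasure
  rw [Measure.restrict_union hd hS', withDensity_add_measure]

lemma lintegral_powerMeasure (c α : ℝ) (S : Set ℝ) {f : ℝ → ℝ≥0∞} (hf : Measurable f) :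
    ∫⁻ z, f z ∂powerMeasure c α S = ∫⁻ z in S, ENNReal.ofReal (c * z ^ (α - 1)) * f z := by
  rw [powerMeasure, lintegral_withDensity_eq_lintegral_mul _ (by fun_prop) hf]
  rfl

variable {c α L : ℝ}

lemma powerMeasure_Ioi_zero_ne_zero (hc : 0 < c) : powerMeasure c α (Ioi 0) ≠ 0 := by
  intro h
  rw [powerMeasure, withDensity_eq_zero_iff (by fun_prop)] at h
  have hfalse : ∀ᵐ _ ∂volume.restrict (Ioi (0 : ℝ)), False := by
    filter_upwards [h, ae_restrict_mem measurableSet_Ioi] with z hz (hz0 : 0 < z)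
    have hpos : 0 < c * z ^ (α - 1) := by positivity
    exact (ENNReal.ofReal_pos.2 hpos).ne' hz
  have hvol := Measure.restrict_eq_zero.1 (ae_eq_bot.1 (eventually_false_iff_eq_bot.1 hfalse))
  simp at hvol

lemma lintegral_inv_pow_powerMeasure_Ioi (hc : 0 ≤ c) (hL : 0 < L) {k : ℕ} (hα : α < k) :
    ∫⁻ z, ENNReal.ofReal (1 / z ^ k) ∂powerMeasure c α (Ioi L) =
      ENNReal.ofReal (c * L ^ (-(k - α)) / (k - α)) := by
  have hexp : α - 1 - k < -1 := by linarith
  have hvalue : ∫ z in Ioi L, c * z ^ (α - 1 - k) = c * L ^ (-(k - α)) / (k - α) := by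
    rw [integral_const_mul, integral_Ioi_rpow_of_lt hexp hL, ← neg_div_neg_eq, neg_neg,
      mul_div_assoc]
    congr 3 <;> ring
  rw [lintegral_powerMeasure c α _ (by fun_prop), ← hvalue, ofReal_integral_eq_lintegral_ofReal
    ((integrableOn_Ioi_rpow_of_lt hexp hL).const_mul c)]
  · refine setLIntegral_congr_fun measurableSet_Ioi fun z (hz : L < z) => ?_
    have hz0 : 0 < z := hL.trans hz
    rw [← ENNReal.ofReal_mul (by positivity), Real.rpow_sub hz0 _ k, Real.rpow_natCast]
    congr 1
    ring
  · filter_upwards [ae_restrict_mem measurableSet_Ioi] with z (hz : L < z)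
    have hz0 : 0 < z := hL.trans hz
    positivity

lemma ae_lt_conv {ρ ν : Measure ℝ} {b : ℝ} (hρ : ∀ᵐ a ∂ρ, 0 ≤ a)
    (hν : ∀ᵐ z ∂ν, b < z) : ∀ᵐ a ∂(ρ ∗ ν), b < a := by
  rw [Measure.conv, ae_map_iff (by fun_prop) measurableSet_Ioi]
  filter_upwards [Measure.quasiMeasurePreserving_fst.ae hρ,
    Measure.quasiMeasurePreserving_snd.ae hν] with p hp hq using lt_add_of_nonneg_of_lt hp hq

lemma conv_ne_zero {ρ ν : Measure ℝ} [SFinite ν] (hρ : ρ ≠ 0) (hν : ν ≠ 0) : ρ ∗ ν ≠ 0 := by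
  rw [← Measure.measure_univ_ne_zero, Measure.conv, Measure.map_apply (by fun_prop) .univ,
    preimage_univ, ← univ_prod_univ, Measure.prod_prod]
  exact mul_ne_zero (Measure.measure_univ_ne_zero.2 hρ) (Measure.measure_univ_ne_zero.2 hν)

variable {ρ : Measure ℝ} [IsProbabilityMeasure ρ]

lemma lintegral_inv_pow_conv_le (hρ : ∀ᵐ a ∂ρ, 0 ≤ a) (hc : 0 ≤ c) (hL : 0 < L) {k : ℕ}
    (hα : α < k) :
    ∫⁻ a, ENNReal.ofReal (1 / a ^ k) ∂(ρ ∗ powerMeasure c α (Ioi L)) ≤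
      ENNReal.ofReal (c * L ^ (-(k - α)) / (k - α)) := by
  rw [Measure.lintegral_conv (by fun_prop)]
  calc ∫⁻ a, ∫⁻ z, ENNReal.ofReal (1 / (a + z) ^ k) ∂powerMeasure c α (Ioi L) ∂ρ
      ≤ ∫⁻ _, ∫⁻ z, ENNReal.ofReal (1 / z ^ k) ∂powerMeasure c α (Ioi L) ∂ρ := by
        refine lintegral_mono_ae ?_
        filter_upwards [hρ] with a ha
        refine lintegral_mono_ae ?_
        filter_upwards [ae_mem_powerMeasure c α measurableSet_Ioi] with z (hz : L < z)
        have hz0 : 0 < z := hL.trans hz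
        gcongr
        linarith
    _ = _ := by rw [lintegral_inv_pow_powerMeasure_Ioi hc hL hα, lintegral_const, measure_univ,
        mul_one]

lemma exists_le_lintegral_inv_pow_conv (hρ : ∀ᵐ a ∂ρ, 0 ≤ a) (hc : 0 < c) {k : ℕ} (hα : α < k) :
    ∃ b > 0, ∀ᶠ L in atTop, ENNReal.ofReal (b * L ^ (-(k - α))) ≤
      ∫⁻ a, ENNReal.ofReal (1 / a ^ k) ∂(ρ ∗ powerMeasure c α (Ioi L)) := by
  obtain ⟨n, hn⟩ : ∃ n : ℕ, 0 < ρ (Iic (n : ℝ)) := by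
    refine exists_measure_pos_of_not_measure_iUnion_null ?_
    have hunion : ⋃ n : ℕ, Iic (n : ℝ) = univ :=
      iUnion_Iic_of_not_bddAbove_range (not_bddAbove_of_tendsto_atTop tendsto_natCast_atTop_atTop)
    simp [hunion]
  have hp : 0 < ρ.real (Iic (n : ℝ)) := ENNReal.toReal_pos hn.ne' (measure_ne_top _ _)
  refine ⟨(1 / 2) ^ k * (c / (k - α)) * ρ.real (Iic (n : ℝ)),
    mul_pos (mul_pos (by positivity) (div_pos hc (sub_pos.2 hα))) hp, ?_⟩
  filter_upwards [eventually_ge_atTop (n : ℝ), eventually_gt_atTop 0] with L hnL hL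
  rw [Measure.lintegral_conv (by fun_prop)]
  calc ENNReal.ofReal ((1 / 2) ^ k * (c / (k - α)) * ρ.real (Iic (n : ℝ)) * L ^ (-(k - α)))
      = ∫⁻ _ in Iic (n : ℝ), ∫⁻ z, ENNReal.ofReal ((1 / 2) ^ k) * ENNReal.ofReal (1 / z ^ k)
          ∂powerMeasure c α (Ioi L) ∂ρ := by
        rw [setLIntegral_const, lintegral_const_mul _ (by fun_prop),
          lintegral_inv_pow_powerMeasure_Ioi hc.le hL hα, ← ofReal_measureReal,
          ← ENNReal.ofReal_mul (by positivity), ← ENNReal.ofReal_mul' hp.le]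
        congr 1
        ring
    _ ≤ ∫⁻ a in Iic (n : ℝ), ∫⁻ z, ENNReal.ofReal (1 / (a + z) ^ k)
          ∂powerMeasure c α (Ioi L) ∂ρ := by
        refine lintegral_mono_ae ?_
        filter_upwards [ae_restrict_of_ae hρ, ae_restrict_mem measurableSet_Iic]
          with a ha (han : a ≤ n)
        refine lintegral_mono_ae ?_
        filter_upwards [ae_mem_powerMeasure c α measurableSet_Ioi] with z (hz : L < z)
        have hz0 : 0 < z := hL.trans hz
        rw [← ENNReal.ofReal_mul (by positivity), ← one_div_pow, ← mul_pow,
          one_div_mul_one_div, one_div_pow]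
        gcongr
        linarith
    _ ≤ _ := setLIntegral_le_lintegral _ _

end MixedPower

section MixedPowerMoments

variable {c α L : ℝ} {ρ : Measure ℝ}

lemma ae_pos_conv_powerMeasure (hρ : ∀ᵐ a ∂ρ, 0 ≤ a) {S : Set ℝ}
    (hS : MeasurableSet S) (hS0 : S ⊆ Ioi 0) : ∀ᵐ a ∂(ρ ∗ powerMeasure c α S), 0 < a :=
  ae_lt_conv hρ ((ae_mem_powerMeasure c α hS).mono hS0)

lemma conv_powerMeasure_Ioi_zero [SFinite ρ] (hL : 0 ≤ L) : ρ ∗ powerMeasure c α (Ioi 0) =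
    ρ ∗ powerMeasure c α (Ioc 0 L) + ρ ∗ powerMeasure c α (Ioi L) := by
  rw [← Ioc_union_Ioi_eq_Ioi hL,
    powerMeasure_union c α (Ioc_disjoint_Ioi le_rfl) measurableSet_Ioi, Measure.conv_add]

variable [IsProbabilityMeasure ρ]

lemma lintegral_mul_exp_powerMeasure_Ioi_zero (hc : 0 ≤ c) (hα : 0 < α) {x : ℝ} (hx : 0 < x)
    (a : ℝ) :
    ∫⁻ z, ENNReal.ofReal (x⁻¹ * Real.exp (-((a + z) * x))) ∂powerMeasure c α (Ioi 0) =
      ENNReal.ofReal (c * Real.Gamma α * x ^ (-(1 + α)) * Real.exp (-(a * x))) := by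
  have hgamma := Real.integral_rpow_mul_exp_neg_mul_Ioi hα hx
  have hvalue : ∫ z in Ioi 0, c * x⁻¹ * Real.exp (-(a * x)) * (z ^ (α - 1) * Real.exp (-(x * z))) =
      c * Real.Gamma α * x ^ (-(1 + α)) * Real.exp (-(a * x)) := by
    rw [integral_const_mul, hgamma, neg_add, Real.rpow_add hx, Real.rpow_neg_one, one_div,
      Real.inv_rpow hx.le, ← Real.rpow_neg hx.le]
    ring
  rw [lintegral_powerMeasure c α _ (by fun_prop), ← hvalue, ofReal_integral_eq_lintegral_ofReal]
  · refine setLIntegral_congr_fun measurableSet_Ioi fun z (hz : 0 < z) => ?_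
    rw [← ENNReal.ofReal_mul (by positivity), add_mul, neg_add, Real.exp_add, mul_comm z x]
    congr 1
    ring
  · refine Integrable.const_mul (Integrable.of_integral_ne_zero ?_) _
    rw [hgamma]
    exact (mul_pos (by positivity) (Real.Gamma_pos_of_pos hα)).ne'
  · filter_upwards [ae_restrict_mem measurableSet_Ioi] with z (hz : 0 < z)
    positivity

theorem thorinLevy_conv_powerMeasure_Ioi_zero (hρ : ∀ᵐ a ∂ρ, 0 ≤ a) (hc : 0 ≤ c) (hα : 0 < α) :
    thorinLevy (ρ ∗ powerMeasure c α (Ioi 0)) = (volume.restrict (Ioi 0)).withDensity fun x =>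
      ENNReal.ofReal (c * Real.Gamma α * x ^ (-(1 + α)) * ∫ a, Real.exp (-(a * x)) ∂ρ) := by
  refine withDensity_congr_ae ?_
  filter_upwards [ae_restrict_mem measurableSet_Ioi] with x (hx : 0 < x)
  have hint : Integrable (fun a => Real.exp (-(a * x))) ρ := by
    refine Integrable.of_bound (by fun_prop) 1 ?_
    filter_upwards [hρ] with a ha
    rw [Real.norm_of_nonneg (Real.exp_pos _).le, Real.exp_le_one_iff]
    exact neg_nonpos.2 (mul_nonneg ha hx.le)
  have := Real.Gamma_pos_of_pos hα
  rw [Measure.lintegral_conv (by fun_prop)]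
  simp_rw [lintegral_mul_exp_powerMeasure_Ioi_zero hc hα hx]
  rw [← integral_const_mul, ofReal_integral_eq_lintegral_ofReal (hint.const_mul _)
    (ae_of_all _ fun a => by positivity)]

section Remainder

variable (hρ : ∀ᵐ a ∂ρ, 0 ≤ a) (hc : 0 < c)

include hρ hc

lemma lintegral_pow_thorinLevy_conv_le (hL : 0 < L) {k : ℕ} (hα : α < k + 1) :
    ∫⁻ x, ENNReal.ofReal (x ^ (k + 1)) ∂thorinLevy (ρ ∗ powerMeasure c α (Ioi L)) ≤
      ENNReal.ofReal (k.factorial * (c * L ^ (-(k + 1 - α)) / (k + 1 - α))) := by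
  rw [lintegral_pow_thorinLevy
    (ae_pos_conv_powerMeasure hρ measurableSet_Ioi (Ioi_subset_Ioi hL.le)),
    ENNReal.ofReal_mul (by positivity)]
  gcongr
  exact_mod_cast lintegral_inv_pow_conv_le hρ hc.le hL (k := k + 1) (by exact_mod_cast hα)

lemma integrable_pow_thorinLevy_conv (hL : 0 < L) {k : ℕ} (hα : α < k + 1) :
    Integrable (fun x => x ^ (k + 1)) (thorinLevy (ρ ∗ powerMeasure c α (Ioi L))) :=
  ⟨by fun_prop, (hasFiniteIntegral_iff_ofReal
    ((ae_nonneg_thorinLevy _).mono fun _ hx => pow_nonneg hx _)).2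
      ((lintegral_pow_thorinLevy_conv_le hρ hc hL hα).trans_lt ENNReal.ofReal_lt_top)⟩

lemma integral_pow_thorinLevy_conv_le (hL : 0 < L) {k : ℕ} (hα : α < k + 1) :
    ∫ x, x ^ (k + 1) ∂thorinLevy (ρ ∗ powerMeasure c α (Ioi L)) ≤
      k.factorial * (c * L ^ (-(k + 1 - α)) / (k + 1 - α)) := by
  have hle := lintegral_pow_thorinLevy_conv_le hρ hc hL hα
  have hkα : 0 < k + 1 - α := sub_pos.2 hα
  rwa [← ofReal_integral_eq_lintegral_ofReal (integrable_pow_thorinLevy_conv hρ hc hL hα)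
    ((ae_nonneg_thorinLevy _).mono fun _ hx => pow_nonneg hx _),
    ENNReal.ofReal_le_ofReal_iff (by positivity)] at hle

lemma exists_le_integral_sq_thorinLevy_conv (hα : α < 2) :
    ∃ b > 0, ∀ᶠ L in atTop,
      b * L ^ (-(2 - α)) ≤ ∫ x, x ^ 2 ∂thorinLevy (ρ ∗ powerMeasure c α (Ioi L)) := by
  obtain ⟨b, hb, hle⟩ := exists_le_lintegral_inv_pow_conv hρ hc (k := 2) (by exact_mod_cast hα)
  refine ⟨b, hb, ?_⟩
  filter_upwards [hle, eventually_gt_atTop 0] with L hleL hL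
  have hint := integrable_pow_thorinLevy_conv hρ hc hL (k := 1) (by norm_num; exact hα)
  have hmoment := lintegral_pow_thorinLevy
    (ae_pos_conv_powerMeasure (c := c) (α := α) hρ measurableSet_Ioi (Ioi_subset_Ioi hL.le)) 1
  rw [Nat.factorial_one, Nat.cast_one, ENNReal.ofReal_one, one_mul,
    ← ofReal_integral_eq_lintegral_ofReal hint (ae_of_all _ fun x => sq_nonneg x)] at hmoment
  rw [← hmoment] at hleL
  exact (ENNReal.ofReal_le_ofReal_iff (integral_nonneg fun x => sq_nonneg x)).1 hleL

lemma eventually_integral_sq_thorinLevy_conv_pos (hα : α < 2) :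
    ∀ᶠ L in atTop, 0 < ∫ x, x ^ 2 ∂thorinLevy (ρ ∗ powerMeasure c α (Ioi L)) := by
  obtain ⟨b, hb, hle⟩ := exists_le_integral_sq_thorinLevy_conv hρ hc hα
  filter_upwards [hle, eventually_gt_atTop 0] with L hleL hL
  exact lt_of_lt_of_le (by positivity) hleL

lemma tendsto_lyapunov_ratio_thorinLevy_conv (hα : 0 < α) (hα2 : α < 2) :
    Tendsto (fun L => (∫ x, x ^ 3 ∂thorinLevy (ρ ∗ powerMeasure c α (Ioi L))) /
      √(∫ x, x ^ 2 ∂thorinLevy (ρ ∗ powerMeasure c α (Ioi L))) ^ 3) atTop (𝓝 0) := by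
  obtain ⟨b, hb, hle⟩ := exists_le_integral_sq_thorinLevy_conv hρ hc hα2
  have hlim : Tendsto (fun L : ℝ => 2 * (c / (3 - α)) / √b ^ 3 * L ^ (-(α / 2))) atTop (𝓝 0) := by
    simpa using (tendsto_rpow_neg_atTop (half_pos hα)).const_mul (2 * (c / (3 - α)) / √b ^ 3)
  refine squeeze_zero' (Eventually.of_forall fun L => ?_) ?_ hlim
  · refine div_nonneg (integral_nonneg_of_ae ?_) (by positivity)
    exact (ae_nonneg_thorinLevy _).mono fun x hx => pow_nonneg hx _
  filter_upwards [hle, eventually_gt_atTop 0] with L hsecond hL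
  have hα3 : 0 < 3 - α := by linarith
  have hthird : ∫ x, x ^ 3 ∂thorinLevy (ρ ∗ powerMeasure c α (Ioi L)) ≤
      2 * (c * L ^ (-(3 - α)) / (3 - α)) := by
    have := integral_pow_thorinLevy_conv_le hρ hc hL (k := 2) (α := α)
      (by push_cast; linarith)
    norm_num at this ⊢
    exact this
  have hsqrt : √b * L ^ (-(1 - α / 2)) ≤
      √(∫ x, x ^ 2 ∂thorinLevy (ρ ∗ powerMeasure c α (Ioi L))) := by
    refine Real.le_sqrt_of_sq_le (le_trans (le_of_eq ?_) hsecond)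
    rw [mul_pow, Real.sq_sqrt hb.le, ← Real.rpow_mul_natCast hL.le]
    congr 2
    push_cast
    ring
  have hcancel : L ^ (-(3 - α)) = L ^ (-(α / 2)) * (L ^ (-(1 - α / 2))) ^ 3 := by
    rw [← Real.rpow_mul_natCast hL.le, ← Real.rpow_add hL]
    congr 1
    push_cast
    ring
  calc _ ≤ 2 * (c * L ^ (-(3 - α)) / (3 - α)) / (√b * L ^ (-(1 - α / 2))) ^ 3 := by gcongr
    _ = 2 * (c / (3 - α)) / √b ^ 3 * L ^ (-(α / 2)) := by
      rw [hcancel]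
      field_simp

end Remainder

end MixedPowerMoments

section Subordinator

variable {Ω : Type*} [MeasurableSpace Ω] {P : Measure Ω} {T : ℝ≥0 → Ω → ℝ} {ν : ℝ → ℝ}

lemma IsSubordinator.ae_nonneg (hT : IsSubordinator T P) (s : ℝ≥0) :
    ∀ᵐ x ∂P.map (T s), 0 ≤ x := by
  rw [ae_map_iff (hT.measurable s).aemeasurable measurableSet_Ici]
  filter_upwards [hT.zero, hT.paths] with ω hzero hpath
  exact hzero ▸ hpath.1 (zero_le (a := s))

/-- The measure `s ν(x) dx` on `(0, ∞)`: the Lévy measure of the marginal at time `s` of a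
subordinator with Lévy density `ν`. -/
def marginalLevyMeasure (s : ℝ) (ν : ℝ → ℝ) : Measure ℝ :=
  (volume.restrict (Ioi 0)).withDensity fun x => ENNReal.ofReal (s * ν x)

instance sFinite_marginalLevyMeasure (s : ℝ) : SFinite (marginalLevyMeasure s ν) := by
  unfold marginalLevyMeasure; infer_instance

lemma HasLevyDensity.aemeasurable (hν : HasLevyDensity T P ν) :
    AEMeasurable ν (volume.restrict (Ioi 0)) := by
  have hinv : Measurable fun x : ℝ => (min 1 x)⁻¹ := by fun_prop
  refine (hinv.aemeasurable.mul hν.integrable.1.aemeasurable).congr ?_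
  filter_upwards [ae_restrict_mem measurableSet_Ioi] with x (hx : 0 < x)
  exact inv_mul_cancel_left₀ (lt_min one_pos hx).ne' _

lemma HasLevyDensity.ae_nonneg (hν : HasLevyDensity T P ν) {s : ℝ} (hs : 0 ≤ s) :
    ∀ᵐ x ∂volume.restrict (Ioi 0), 0 ≤ s * ν x := by
  filter_upwards [ae_restrict_mem measurableSet_Ioi] with x hx
  exact mul_nonneg hs (hν.nonneg x hx)

lemma HasLevyDensity.integral_marginalLevyMeasure (hν : HasLevyDensity T P ν) {s : ℝ}
    (hs : 0 ≤ s) (f : ℝ → ℝ) :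
    ∫ x, f x ∂marginalLevyMeasure s ν = s * ∫ x in Ioi 0, f x * ν x := by
  rw [marginalLevyMeasure, integral_withDensity_eq_integral_toReal_smul₀
    (hν.aemeasurable.const_mul s).ennreal_ofReal (ae_of_all _ fun _ => ENNReal.ofReal_lt_top),
    ← integral_const_mul]
  refine integral_congr_ae ((hν.ae_nonneg hs).mono fun x hx => ?_)
  beta_reduce
  rw [ENNReal.toReal_ofReal hx, smul_eq_mul]
  ring

lemma HasLevyDensity.isSubordinatorLevyMeasure (hν : HasLevyDensity T P ν) {s : ℝ}
    (hs : 0 ≤ s) : IsSubordinatorLevyMeasure (marginalLevyMeasure s ν) where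
  ae_pos := (withDensity_absolutelyContinuous _ _).ae_le (ae_restrict_mem measurableSet_Ioi)
  lintegral_lt_top := by
    have hmeas := (hν.aemeasurable.const_mul s).ennreal_ofReal
    rw [marginalLevyMeasure, lintegral_withDensity_eq_lintegral_mul₀ hmeas (by fun_prop)]
    refine lt_of_le_of_lt (lintegral_mono_ae ?_) (hν.integrable.const_mul s).lintegral_lt_top
    filter_upwards [hν.ae_nonneg hs] with x hsν
    have hmin : 1 - Real.exp (-x) ≤ min 1 x :=
      le_min (by linarith [Real.exp_pos (-x)]) (by linarith [Real.add_one_le_exp (-x)])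
    rw [Pi.mul_apply, ← ENNReal.ofReal_mul hsν]
    refine ENNReal.ofReal_le_ofReal ?_
    calc s * ν x * (1 - Real.exp (-x)) ≤ s * ν x * min 1 x := by gcongr
      _ = s * (min 1 x * ν x) := by ring

theorem IsSubordinator.hasLevyMeasure_map [IsProbabilityMeasure P] (hT : IsSubordinator T P)
    (hν : HasLevyDensity T P ν) (s : ℝ≥0) :
    HasLevyMeasure (P.map (T s)) (marginalLevyMeasure s ν) := by
  obtain ⟨μ, hμ⟩ := exists_hasLevyMeasure (hν.isSubordinatorLevyMeasure s.coe_nonneg)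
  have := hμ.prob
  have heq : P.map (T s) = μ := by
    refine ext_of_laplace (hT.ae_nonneg s) hμ.nonneg fun u hu => ?_
    rw [hμ.laplace hu, integral_map (hT.measurable s).aemeasurable (by fun_prop),
      hν.laplace s u hu, hν.integral_marginalLevyMeasure s.coe_nonneg, neg_mul]
  rwa [heq]

/-- The increment of the subordinator over `(s, 2s]` is independent of its value at `s` and has a
diffuse law, so it serves as the source of randomness for splitting that value. -/
theorem IsSubordinator.exists_indepFun_add [IsProbabilityMeasure P] (hT : IsSubordinator T P)
    (hν : HasLevyDensity T P ν) {s : ℝ≥0} (htop : marginalLevyMeasure s ν univ = ∞)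
    {Λ₁ Λ₂ : Measure ℝ} [SFinite Λ₁] [SFinite Λ₂] (hΛ : marginalLevyMeasure s ν = Λ₁ + Λ₂) :
    ∃ A, Measurable A ∧ IndepFun A (T s - A) P ∧ HasLevyMeasure (P.map A) Λ₁ ∧
      HasLevyMeasure (P.map (T s - A)) Λ₂ := by
  have hlaw := hT.hasLevyMeasure_map hν s
  have hatom (c : ℝ) : marginalLevyMeasure s ν {c} = 0 :=
    withDensity_absolutelyContinuous _ _ (by simp)
  refine exists_indepFun_add_of_hasLevyMeasure (hT.measurable s)
    ((hT.measurable (s + s)).sub (hT.measurable s))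
    (hT.indep.indepFun_eval_sub zero_le le_self_add hT.zero) (fun c => ?_) (hΛ ▸ hlaw)
  exact (hT.stationary s s).map_eq ▸ hlaw.measure_singleton_eq_zero hatom htop c

end Subordinator

section TimeChange

variable {C G M Y t : ℝ}

lemma isProbabilityMeasure_ratioLaw (hY : 0 < Y) : IsProbabilityMeasure (ratioLaw Y) := by
  have := isProbabilityMeasure_gammaMeasure (half_pos hY) one_pos
  have := isProbabilityMeasure_gammaMeasure (a := 1 / 2) one_half_pos one_pos
  exact Measure.isProbabilityMeasure_map (by fun_prop)

lemma ae_nonneg_gammaMeasure (a r : ℝ) : ∀ᵐ x ∂gammaMeasure a r, 0 ≤ x := by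
  rw [gammaMeasure, ae_withDensity_iff (by unfold gammaPDF; fun_prop)]
  exact ae_of_all _ fun x hx => not_lt.1 (mt gammaPDF_of_neg hx)

/-- The law of `(G M + θ̃² ℛ) / 2`, the random shift of the Thorin measure of the time change. -/
def rateLaw (G M Y : ℝ) : Measure ℝ :=
  (ratioLaw Y).map fun r => (G * M + (thetaTilde G M) ^ 2 * r) / 2

instance sFinite_ratioLaw (Y : ℝ) : SFinite (ratioLaw Y) := by
  unfold ratioLaw gammaMeasure; infer_instance

instance sFinite_rateLaw (G M Y : ℝ) : SFinite (rateLaw G M Y) := by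
  unfold rateLaw; infer_instance

lemma isProbabilityMeasure_rateLaw (hY : 0 < Y) : IsProbabilityMeasure (rateLaw G M Y) :=
  have := isProbabilityMeasure_ratioLaw hY
  Measure.isProbabilityMeasure_map (by fun_prop)

lemma ae_nonneg_ratioLaw (Y : ℝ) : ∀ᵐ r ∂ratioLaw Y, 0 ≤ r := by
  rw [ratioLaw, ae_map_iff (by fun_prop) measurableSet_Ici]
  filter_upwards [Measure.quasiMeasurePreserving_fst.ae (ae_nonneg_gammaMeasure (Y / 2) 1),
    Measure.quasiMeasurePreserving_snd.ae (ae_nonneg_gammaMeasure (1 / 2) 1)] with p hp hq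
  exact div_nonneg hp hq

lemma ae_nonneg_rateLaw (hG : 0 ≤ G) (hM : 0 ≤ M) (Y : ℝ) : ∀ᵐ a ∂rateLaw G M Y, 0 ≤ a := by
  rw [rateLaw, ae_map_iff (by fun_prop) measurableSet_Ici]
  filter_upwards [ae_nonneg_ratioLaw Y] with r hr
  change 0 ≤ (G * M + (thetaTilde G M) ^ 2 * r) / 2
  positivity

lemma cTilde_pos (hC : 0 < C) (hY : 0 < Y) (ht : 0 < t) : 0 < cTilde C Y t := by
  have := Real.Gamma_pos_of_pos hY
  unfold cTilde
  positivity

lemma integral_exp_neg_mul_rateLaw (x : ℝ) :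
    ∫ a, Real.exp (-(a * x)) ∂rateLaw G M Y = Real.exp (-(G * M) * x / 2) *
      ∫ r, Real.exp (-((thetaTilde G M) ^ 2 * x / 2) * r) ∂ratioLaw Y := by
  rw [rateLaw, integral_map (by fun_prop) (by fun_prop), ← integral_const_mul]
  refine integral_congr_ae (ae_of_all _ fun r => ?_)
  beta_reduce
  rw [← Real.exp_add]
  ring_nf

theorem marginalLevyMeasure_timeChangeLevyDensity (hC : 0 ≤ C) (hG : 0 ≤ G) (hM : 0 ≤ M)
    (hY : 0 < Y) (ht : 0 ≤ t) :
    marginalLevyMeasure t (timeChangeLevyDensity C G M Y) =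
      thorinLevy (rateLaw G M Y ∗ powerMeasure (cTilde C Y t) (Y / 2) (Ioi 0)) := by
  have := isProbabilityMeasure_rateLaw (G := G) (M := M) hY
  have := Real.Gamma_pos_of_pos hY
  have hc : 0 ≤ cTilde C Y t := by unfold cTilde; positivity
  rw [thorinLevy_conv_powerMeasure_Ioi_zero (ae_nonneg_rateLaw hG hM Y) hc (half_pos hY)]
  refine withDensity_congr_ae ?_
  filter_upwards [ae_restrict_mem measurableSet_Ioi] with x (hx : 0 < x)
  have hGM : (thetaTilde G M) ^ 2 - (theta G M) ^ 2 = G * M := by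
    unfold thetaTilde theta; ring
  rw [integral_exp_neg_mul_rateLaw, timeChangeLevyDensity, hGM, cTilde, Real.rpow_neg hx.le]
  congr 1
  ring

end TimeChange

section Truncation

variable {G M Y L c : ℝ}

instance sFinite_zLaw (Y L : ℝ) : SFinite (zLaw Y L) := by
  unfold zLaw; infer_instance

lemma powerMeasure_Ioc_eq_smul_zLaw (hc : 0 ≤ c) (hY : 0 < Y) (hL : 0 < L) :
    powerMeasure c (Y / 2) (Ioc 0 L) =
      ENNReal.ofReal (2 * c * L ^ (Y / 2) / Y) • zLaw Y L := by
  unfold powerMeasure zLaw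
  rw [← withDensity_smul _ (by fun_prop), ← Measure.restrict_congr_set Ioc_ae_eq_Icc]
  refine withDensity_congr_ae (ae_of_all _ fun z => ?_)
  rw [Pi.smul_apply, smul_eq_mul, ← ENNReal.ofReal_mul (by positivity), Real.rpow_neg hL.le]
  field_simp

lemma rLaw_eq_map_conv : rLaw G M Y L = (rateLaw G M Y ∗ zLaw Y L).map fun a => 1 / a := by
  rw [Measure.conv, rateLaw, ← Measure.map_id (μ := zLaw Y L), Measure.map_prod_map _ _
    (by fun_prop) measurable_id, Measure.map_map (by fun_prop) (by fun_prop),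
    Measure.map_map (by fun_prop) (by fun_prop)]
  rfl

lemma integral_rLaw_eq (hc : 0 < c) (hY : 0 < Y) (hL : 0 < L) {f : ℝ → ℝ} (hf : Measurable f) :
    2 * c * L ^ (Y / 2) / Y * ∫ r, f r ∂rLaw G M Y L =
      ∫ a, f (1 / a) ∂(rateLaw G M Y ∗ powerMeasure c (Y / 2) (Ioc 0 L)) := by
  rw [powerMeasure_Ioc_eq_smul_zLaw hc.le hY hL, Measure.conv_smul_right, integral_smul_measure,
    ENNReal.toReal_ofReal (by positivity), rLaw_eq_map_conv,
    integral_map (by fun_prop) hf.aestronglyMeasurable, smul_eq_mul]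

lemma integrable_rLaw_iff (hc : 0 < c) (hY : 0 < Y) (hL : 0 < L) {f : ℝ → ℝ} (hf : Measurable f) :
    Integrable f (rLaw G M Y L) ↔ Integrable (fun a => f (1 / a))
      (rateLaw G M Y ∗ powerMeasure c (Y / 2) (Ioc 0 L)) := by
  rw [powerMeasure_Ioc_eq_smul_zLaw hc.le hY hL, Measure.conv_smul_right, integrable_smul_measure
    (by rw [← pos_iff_ne_zero, ENNReal.ofReal_pos]; positivity) ENNReal.ofReal_ne_top,
    rLaw_eq_map_conv, integrable_map_measure hf.aestronglyMeasurable (by fun_prop)]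
  rfl

end Truncation

section TruncatedTimeChange

variable {Ω : Type*} [MeasurableSpace Ω] {P : Measure Ω}

section Remainder

variable {c α : ℝ} {ρ : Measure ℝ} [IsProbabilityMeasure ρ] (hρ : ∀ᵐ a ∂ρ, 0 ≤ a) (hc : 0 < c)

include hρ hc

lemma memLp_two_of_hasLevyMeasure_thorinLevy_conv {X : Ω → ℝ} {L : ℝ} (hX : Measurable X)
    (h : HasLevyMeasure (P.map X) (thorinLevy (ρ ∗ powerMeasure c α (Ioi L)))) (hL : 0 < L)
    (hα : α < 1) : MemLp X 2 P := by
  refine h.memLp_two_of_map hX ?_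
    (integrable_pow_thorinLevy_conv hρ hc hL (k := 1) (by push_cast; linarith))
  simpa using integrable_pow_thorinLevy_conv hρ hc hL (k := 0) (by simpa using hα)

lemma integral_sq_le_of_hasLevyMeasure_thorinLevy_conv {X : Ω → ℝ} {L : ℝ} (hX : Measurable X)
    (h : HasLevyMeasure (P.map X) (thorinLevy (ρ ∗ powerMeasure c α (Ioi L)))) (hL : 0 < L)
    (hα : α < 1) :
    ∫ ω, X ω ^ 2 ∂P ≤
      c ^ 2 / ((1 - α) ^ 2 * L ^ (2 - 2 * α)) + c / ((2 - α) * L ^ (2 - α)) := by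
  have hint1 := integrable_pow_thorinLevy_conv hρ hc hL (k := 0) (by simpa using hα)
  have hint2 := integrable_pow_thorinLevy_conv hρ hc hL (k := 1) (α := α) (by push_cast; linarith)
  have hfirst := integral_pow_thorinLevy_conv_le hρ hc hL (k := 0) (by simpa using hα)
  have hsecond := integral_pow_thorinLevy_conv_le hρ hc hL (k := 1) (α := α)
    (by push_cast; linarith)
  norm_num at hint1 hint2 hfirst hsecond
  have hsq : (L ^ (-(1 - α))) ^ 2 = (L ^ (2 - 2 * α))⁻¹ := by
    rw [← Real.rpow_mul_natCast hL.le, ← Real.rpow_neg hL.le]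
    congr 1
    push_cast
    ring
  rw [h.integral_sq_eq hX hint1 hint2]
  have hnonneg : 0 ≤ ∫ x, x ∂thorinLevy (ρ ∗ powerMeasure c α (Ioi L)) :=
    integral_nonneg_of_ae (ae_nonneg_thorinLevy _)
  calc _ ≤ (c * L ^ (-(1 - α)) / (1 - α)) ^ 2 + c * L ^ (-(2 - α)) / (2 - α) := by
        gcongr
        · simpa using hfirst
        · simpa using hsecond
    _ = _ := by
      rw [div_pow, mul_pow, hsq, Real.rpow_neg hL.le]
      have : 1 - α ≠ 0 := by linarith
      have : 2 - α ≠ 0 := by linarith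
      field_simp

theorem tendstoInDistribution_standardized_of_hasLevyMeasure_thorinLevy_conv
    [IsProbabilityMeasure P] {X : ℝ → Ω → ℝ} (hX : ∀ L, Measurable (X L))
    (h : ∀ L, 0 < L → HasLevyMeasure (P.map (X L)) (thorinLevy (ρ ∗ powerMeasure c α (Ioi L))))
    (hα : 0 < α) (hα1 : α < 1) :
    TendstoInDistribution
      (fun L ω => (X L ω - ∫ ω', X L ω' ∂P) / √(variance (X L) P))
      atTop id (fun _ => P) (gaussianReal 0 1) := by
  have hpos := eventually_gt_atTop (0 : ℝ)
  have hint (k : ℕ) : ∀ᶠ L in atTop,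
      Integrable (fun x => x ^ (k + 1)) (thorinLevy (ρ ∗ powerMeasure c α (Ioi L))) :=
    hpos.mono fun L hL => integrable_pow_thorinLevy_conv hρ hc hL
      (hα1.trans_le (le_add_of_nonneg_left k.cast_nonneg))
  exact tendstoInDistribution_gaussianReal_of_hasLevyMeasure hX (hpos.mono h)
    (by simpa using hint 0) (hint 2)
    (eventually_integral_sq_thorinLevy_conv_pos hρ hc (hα1.trans one_lt_two))
    (tendsto_lyapunov_ratio_thorinLevy_conv hρ hc hα (hα1.trans one_lt_two))

end Remainder

variable {C G M Y : ℝ} {T : ℝ≥0 → Ω → ℝ} {t : ℝ≥0}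

theorem exists_indepFun_truncation [IsProbabilityMeasure P] (hC : 0 < C) (hG : 0 ≤ G)
    (hM : 0 ≤ M) (hY : 0 < Y) (hT : IsSubordinator T P)
    (hν : HasLevyDensity T P (timeChangeLevyDensity C G M Y)) (ht : 0 < t) :
    ∃ A : ℝ → Ω → ℝ, (∀ L, Measurable (A L)) ∧ ∀ L, 0 < L →
      IndepFun (A L) (T t - A L) P ∧
      HasLevyMeasure (P.map (A L))
        (thorinLevy (rateLaw G M Y ∗ powerMeasure (cTilde C Y t) (Y / 2) (Ioc 0 L))) ∧
      HasLevyMeasure (P.map (T t - A L))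
        (thorinLevy (rateLaw G M Y ∗ powerMeasure (cTilde C Y t) (Y / 2) (Ioi L))) := by
  have := isProbabilityMeasure_rateLaw (G := G) (M := M) hY
  have hρ := ae_nonneg_rateLaw hG hM Y
  have hlevy := marginalLevyMeasure_timeChangeLevyDensity hC.le hG hM hY t.coe_nonneg
  have htop : marginalLevyMeasure t (timeChangeLevyDensity C G M Y) univ = ∞ :=
    hlevy ▸ thorinLevy_univ_eq_top (ae_pos_conv_powerMeasure hρ measurableSet_Ioi le_rfl)
      (conv_ne_zero (IsProbabilityMeasure.ne_zero _)
        (powerMeasure_Ioi_zero_ne_zero (cTilde_pos hC hY ht)))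
  have hadd {L : ℝ} (hL : 0 < L) : marginalLevyMeasure t (timeChangeLevyDensity C G M Y) =
      thorinLevy (rateLaw G M Y ∗ powerMeasure (cTilde C Y t) (Y / 2) (Ioc 0 L)) +
        thorinLevy (rateLaw G M Y ∗ powerMeasure (cTilde C Y t) (Y / 2) (Ioi L)) := by
    rw [hlevy, conv_powerMeasure_Ioi_zero hL.le, thorinLevy_add]
  have hex (L : ℝ) : ∃ A : Ω → ℝ, Measurable A ∧ (0 < L → _) :=
    if hL : 0 < L then
      let ⟨A, hA, h⟩ := hT.exists_indepFun_add hν htop (hadd hL)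
      ⟨A, hA, fun _ => h⟩
    else ⟨0, measurable_zero, fun h => absurd h hL⟩
  choose A hA h using hex
  exact ⟨A, hA, h⟩

theorem neg_log_integral_exp_eq_of_hasLevyMeasure {X : Ω → ℝ} {c L u : ℝ} (hX : Measurable X)
    (h : HasLevyMeasure (P.map X) (thorinLevy (rateLaw G M Y ∗ powerMeasure c (Y / 2) (Ioc 0 L))))
    (hG : 0 ≤ G) (hM : 0 ≤ M) (hY : 0 < Y) (hc : 0 < c) (hL : 0 < L) (hu : 0 ≤ u) :
    Integrable (fun r => Real.log (1 + u * r)) (rLaw G M Y L) ∧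
      -Real.log (∫ ω, Real.exp (-u * X ω) ∂P) =
        2 * c * L ^ (Y / 2) / Y * ∫ r, Real.log (1 + u * r) ∂rLaw G M Y L := by
  have hU := ae_pos_conv_powerMeasure (c := c) (α := Y / 2) (ae_nonneg_rateLaw hG hM Y)
    measurableSet_Ioc (S := Ioc 0 L) Ioc_subset_Ioi_self
  have hlog : Measurable fun r : ℝ => Real.log (1 + u * r) := by fun_prop
  rw [integrable_rLaw_iff hc hY hL hlog, integral_rLaw_eq hc hY hL hlog]
  simp only [mul_one_div]
  refine ⟨integrable_log_one_add_div hU h.levy hu, ?_⟩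
  have hlaplace := h.laplace hu
  rw [integral_map hX.aemeasurable (by fun_prop)] at hlaplace
  rw [hlaplace, Real.log_exp, neg_neg, integral_one_sub_exp_thorinLevy hU hu]

end TruncatedTimeChange

end CGMY

end

theorem theorem1 {Ω : Type*} [MeasurableSpace Ω] (P : Measure Ω) [IsProbabilityMeasure P]
    (C G M Y : ℝ) (hC : 0 < C) (hG : 0 ≤ G) (hM : 0 ≤ M) (hY0 : 0 < Y) (hY2 : Y < 2)
    (T : ℝ≥0 → Ω → ℝ) (hT : CGMY.IsSubordinator T P)
    (hν : CGMY.HasLevyDensity T P (CGMY.timeChangeLevyDensity C G M Y))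
    (t : ℝ≥0) (ht : 0 < t) :
    ∃ TL ε : ℝ → Ω → ℝ,
      (∀ L : ℝ, 0 < L →
        Measurable (TL L) ∧ Measurable (ε L) ∧
        (∀ ω, T t ω = TL L ω + ε L ω) ∧
        IndepFun (TL L) (ε L) P ∧
        CGMY.IsGenGammaConvolution (P.map (TL L)) ∧
        (∀ u : ℝ, 0 < u →
          Integrable (fun r => Real.log (1 + u * r)) (CGMY.rLaw G M Y L) ∧
          -Real.log (∫ ω, Real.exp (-u * TL L ω) ∂P) =
            2 * CGMY.cTilde C Y t * L ^ (Y / 2) / Y *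
              ∫ r, Real.log (1 + u * r) ∂(CGMY.rLaw G M Y L)) ∧
        MemLp (ε L) 2 P ∧
        ∫ ω, (ε L ω) ^ 2 ∂P ≤
          (CGMY.cTilde C Y t) ^ 2 / ((1 - Y / 2) ^ 2 * L ^ (2 - Y)) +
            CGMY.cTilde C Y t / ((2 - Y / 2) * L ^ (2 - Y / 2))) ∧
      TendstoInDistribution
        (fun (L : ℝ) ω => (ε L ω - ∫ ω', ε L ω' ∂P) / Real.sqrt (variance (ε L) P))
        atTop (id : ℝ → ℝ) (fun _ => P) (gaussianReal 0 1) := by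
  open CGMY in
  have := isProbabilityMeasure_rateLaw (G := G) (M := M) hY0
  have hρ := ae_nonneg_rateLaw hG hM Y
  have hc : 0 < cTilde C Y t := cTilde_pos hC hY0 ht
  have hY1 : Y / 2 < 1 := by linarith
  obtain ⟨A, hA, hsplit⟩ := exists_indepFun_truncation hC hG hM hY0 hT hν ht
  have hε (L : ℝ) : Measurable (T t - A L) := (hT.measurable t).sub (hA L)
  refine ⟨A, fun L => T t - A L, fun L hL => ?_,
    tendstoInDistribution_standardized_of_hasLevyMeasure_thorinLevy_conv hρ hc hε
      (fun L hL => (hsplit L hL).2.2) (half_pos hY0) hY1⟩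
  obtain ⟨hindep, hmain, hrem⟩ := hsplit L hL
  have hU := ae_pos_conv_powerMeasure (c := cTilde C Y t) (α := Y / 2) hρ
    (measurableSet_Ioc (a := 0) (b := L)) Ioc_subset_Ioi_self
  have hsecond := integral_sq_le_of_hasLevyMeasure_thorinLevy_conv hρ hc (hε L) hrem hL hY1
  rw [mul_div_cancel₀ Y two_ne_zero] at hsecond
  exact ⟨hA L, hε L, fun ω => (add_sub_cancel (A L ω) (T t ω)).symm, hindep,
    hmain.isGenGammaConvolution hU,
    fun u hu => neg_log_integral_exp_eq_of_hasLevyMeasure (hA L) hmain hG hM hY0 hc hL hu.le,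
    memLp_two_of_hasLevyMeasure_thorinLevy_conv hρ hc (hε L) hrem hL hY1, hsecond⟩
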